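/- Let $d\ge 1$. For each $\lambda>0$ let $P_\lambda=\{X_i\}$ be a stationary Poisson process in $\mathbb R^d$ of intensity $\lambda$, and let $C_i$ be i.i.d. copies of a random closed set $C\subset\mathbb R^d$, independent of $P_\lambda$. Let $\|\cdot\|$ denote Lebesgue measure, and assume that for some fixed $\tau>0$ almost surely $C$ is contained in the closed ball of radius $\tau$ around the origin and $\|C\|>0$; put $\beta=\mathbb E\|C\|$. For $\delta>0$ consider the scaled Poisson-Boolean model $\mathcal C(\delta,\lambda)=\{X_i+\delta C_i\}$ over the points $X_i$ of $P_\lambda$. Let $R\subseteq\mathbb R^d$ be a Borel set, let $k\ge1$ be an integer, and let the $k$-vacancy $V_k=V_k(\lambda,\delta)$ be the volume of the part of $R$ covered by at most $k-1$ of the sets of $\mathcal C(\delta,\lambda)$, that is, $$V_k=\sum_{m=0}^{k-1}\int_R\chi_m(x)\,dx,\qquad \chi_m(x)=\mathbf 1\{x\in X_i+\delta C_i\text{ for exactly } m \text{ points } X_i \text{ of } P_\lambda\}.$$ Let the processes of all intensities be realized on one probability space in either of the two standard ways, in both of which a point keeps its shape $C_i$ as $\lambda$ varies: (a) nested, $P_\lambda\subseteq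 P_{\lambda'}$ for $\lambda\le\lambda'$; or (b) rescaled, $P_\lambda=\lambda^{-1/d}P_1$. If $\delta=\delta(\lambda)>0$ satisfies $\delta\to0$ as $\lambda\to\infty$ in such a way that $\delta^d\lambda\to\rho$ with $0\le\rho<\infty$, then, as $\lambda\to\infty$, $$V_k\;\longrightarrow\;\|R\|\,e^{-\rho\beta}\sum_{j=0}^{k-1}\frac{(\rho\beta)^j}{j!}\qquad\text{almost surely}$$ (if $\|R\|=\infty$, the right-hand side is read as $\infty$). -/

import Mathlib

open MeasureTheory ProbabilityTheory Filter Topology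
open TopologicalSpace (Closeds)
open scoped ENNReal Pointwise

noncomputable section

namespace PoissonBoolean

/-- The standard σ-algebra for random closed sets (the Effros σ-algebra, i.e. the Borel σ-algebra
of the Fell topology): it is generated by the events "`F` hits `K`" with `K` compact. -/
instance instMeasurableSpaceCloseds (E : Type*) [TopologicalSpace E] :
    MeasurableSpace (Closeds E) :=
  MeasurableSpace.generateFrom
    {s | ∃ K : Set E, IsCompact K ∧ s = {F : Closeds E | ((F : Set E) ∩ K).Nonempty}}

/-- The number of indices `i` in the random index set `I ω` with `X i ω ∈ A`. -/
def pointCount {Ω E : Type*} (X : ℕ → Ω → E) (I : Ω → Set ℕ) (A : Set E) (ω : Ω) : ℕ∞ :=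
  {i : ℕ | i ∈ I ω ∧ X i ω ∈ A}.encard

/-- The random points `X i`, `i ∈ I`, form a Poisson point process with intensity measure `ν`:
the number of points in a measurable set `A` of finite intensity is Poisson with mean `ν A`, and
the numbers of points in finitely many disjoint measurable sets are independent.
(The random index set `I` says which of the points are present.) -/
structure IsPoissonProcess {Ω E : Type*} [MeasurableSpace Ω] [MeasurableSpace E]
    (μ : Measure Ω) (ν : Measure E) (X : ℕ → Ω → E) (I : Ω → Set ℕ) : Prop where
  measurable_point : ∀ i, Measurable (X i)
  measurableSet_index : ∀ i, MeasurableSet {ω | i ∈ I ω}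
  hasLaw_count : ∀ A : Set E, MeasurableSet A → ν A ≠ ∞ →
    HasLaw (pointCount X I A) ((poissonMeasure (ν A).toNNReal).map (Nat.cast : ℕ → ℕ∞)) μ
  indep_count : ∀ (n : ℕ) (A : Fin n → Set E), (∀ j, MeasurableSet (A j)) →
    Pairwise (Function.onFun Disjoint A) → iIndepFun (fun j => pointCount X I (A j)) μ

/-- The ingredients of the Poisson-Boolean model in `ℝ^d` with intensity `lam` and shape law `Q`:
the points `X i`, `i ∈ I`, form a stationary Poisson process of intensity `lam`, and the shapes
`C i` are i.i.d. random closed sets with law `Q`, independent of the point process. -/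
structure IsModel {Ω : Type*} [MeasurableSpace Ω] {d : ℕ} (μ : Measure Ω) (lam : ℝ)
    (Q : Measure (Closeds (EuclideanSpace ℝ (Fin d))))
    (X : ℕ → Ω → EuclideanSpace ℝ (Fin d)) (I : Ω → Set ℕ)
    (C : ℕ → Ω → Closeds (EuclideanSpace ℝ (Fin d))) : Prop where
  poisson : IsPoissonProcess μ (ENNReal.ofReal lam • volume) X I
  measurable_shape : ∀ i, Measurable (C i)
  hasLaw_shape : ∀ i, HasLaw (C i) Q μ
  iIndepFun_shape : iIndepFun C μ
  indepFun_shape_points :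
    IndepFun (fun ω i => C i ω) (fun ω i => ((X i ω, i ∈ I ω) : _ × Prop)) μ

/-- First standard way to realize the processes of all intensities together: the process grows
with the intensity (points, with their shapes, are added and never removed). -/
def IsNested {Ω : Type*} [MeasurableSpace Ω] {d : ℕ} (μ : Measure Ω)
    (X : ℝ → ℕ → Ω → EuclideanSpace ℝ (Fin d)) (I : ℝ → Ω → Set ℕ) : Prop :=
  ∀ᵐ ω ∂μ, ∀ a b : ℝ, 0 < a → a ≤ b → ∀ i ∈ I a ω, i ∈ I b ω ∧ X b i ω = X a i ω

/-- Second standard way: the process of intensity `a` is the process of intensity one shrunk by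
the factor `a ^ (1 / d)`, each point keeping its shape. -/
def IsRescaled {Ω : Type*} [MeasurableSpace Ω] {d : ℕ} (μ : Measure Ω)
    (X : ℝ → ℕ → Ω → EuclideanSpace ℝ (Fin d)) (I : ℝ → Ω → Set ℕ) : Prop :=
  ∀ᵐ ω ∂μ, ∀ a : ℝ, 0 < a → I a ω = I 1 ω ∧
    ∀ i ∈ I 1 ω, X a i ω = (a ^ (-(1 / (d : ℝ)))) • X 1 i ω

open Classical in
/-- `exactlyCovered I X S m x` is `1` if `x` lies in `X i + S i` for exactly `m` of the indices
`i ∈ I`, and `0` otherwise. -/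
def exactlyCovered {E : Type*} [Add E] (I : Set ℕ) (X : ℕ → E) (S : ℕ → Set E)
    (m : ℕ) (x : E) : ℝ≥0∞ :=
  if {i : ℕ | i ∈ I ∧ x ∈ X i +ᵥ S i}.encard = (m : ℕ∞) then 1 else 0

/-- The `k`-vacancy within `R`: the volume of the part of `R` that is covered by at most `k - 1`
of the sets `X i + S i`, `i ∈ I`. -/
def vacancy {d : ℕ} (k : ℕ) (R : Set (EuclideanSpace ℝ (Fin d)))
    (I : Set ℕ) (X : ℕ → EuclideanSpace ℝ (Fin d)) (S : ℕ → Set (EuclideanSpace ℝ (Fin d))) :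
    ℝ≥0∞ :=
  ∑ m ∈ Finset.range k, ∫⁻ x in R, exactlyCovered I X S m x

end PoissonBoolean

end

/-! Let N(x) be the number of scaled sets that cover x, and T(x) = 2^(-N(x)), a field with values in
[0, 1]. Since T(x)^j is a product over the points of the process, the Laplace functional of the
independently marked Poisson process (`IsPoissonProcess.integral_finprod_marked`) gives E T(x)^j =
exp((2^(-j) - 1) δ^d λ β), the j-th moment of 2^(-N) for a Poisson variable N of mean δ^d λ β. It
also shows that T(x)^j and T(y)^j are uncorrelated once |x - y| > 2τδ, so the variance of ∫_A T^j is
O(δ^d) (`integral_sq_sub_le`). Along λ = q^n, with δ chosen so that δ^d λ = ρ exactly, these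
variances are summable, and almost surely all moments ∫_A T^j converge. By Weierstrass approximation
so do the integrals of continuous functions of T, in particular of one that equals the indicator of
N < k on the values 2^(-n) (`ae_tendsto_sparseSet`).

For a general λ between q^n and q^(n+1) the coupling is used (`Coupled.eventually_abs_sub_le`). In
the nested case the vacancy decreases in λ for fixed δ. In the rescaled case two configurations
differ by a dilation with factor near 1, which changes the scale of the shapes and the window A
slightly. In both cases δ has to be replaced by a nearby δ'. Shapes need not be star-shaped, so the
vacancy is not monotone in δ. The error is instead bounded by the sum, over the points near A, of
the volumes of δC_i \ δ'C_i, each at most δ'^d times the volume of a thin shell around C_i. The mean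
shell volume is small because C is closed and bounded, and an exponential moment bound controls the
sums along q^n (`ae_eventually_finsum_le`).

If ρ = 0, the total volume of the sets meeting A is O(δ^d λ), which tends to 0
(`Coupled.tendsto_of_zero`). A Borel set R is exhausted in volume by compact sets, for which the
shell argument also handles the dilated window. -/

namespace PoissonBoolean

/-- The indices of the points present in `B`. -/
def presentIn {Ω E : Type*} (X : ℕ → Ω → E) (I : Ω → Set ℕ) (B : Set E) (ω : Ω) : Set ℕ :=
  {i | i ∈ I ω ∧ X i ω ∈ B}

/-! ### Products over a random finite index set as limits of products over initial segments -/

section FinProd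

open Classical in
theorem prod_range_ite_eventually_eq {s : Set ℕ} (hs : s.Finite) (a : ℕ → ℝ) :
    ∀ᶠ n in atTop, ∏ i ∈ Finset.range n, (if i ∈ s then a i else 1) = ∏ᶠ i ∈ s, a i := by
  obtain ⟨N, hN⟩ := hs.bddAbove
  filter_upwards [eventually_gt_atTop N] with n hn
  rw [finprod_mem_eq_finite_toFinset_prod _ hs, ← Finset.prod_filter]
  congr 1
  ext i
  simp only [Finset.mem_filter, Finset.mem_range, Set.Finite.mem_toFinset, and_iff_right_iff_imp]
  intro hi
  exact lt_of_le_of_lt (hN hi) hn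

open Classical in
theorem prod_range_ite_le_pow {s : Set ℕ} (hs : s.Finite) {a : ℕ → ℝ} {M : ℝ} (hM : 1 ≤ M)
    (h0 : ∀ i, 0 ≤ a i) (hle : ∀ i, a i ≤ M) (n : ℕ) :
    ∏ i ∈ Finset.range n, (if i ∈ s then a i else 1) ≤ M ^ s.ncard := by
  rw [← Finset.prod_filter]
  calc ∏ i ∈ (Finset.range n).filter (· ∈ s), a i
      ≤ ∏ i ∈ (Finset.range n).filter (· ∈ s), M :=
        Finset.prod_le_prod (fun i _ => h0 i) (fun i _ => hle i)
    _ = M ^ ((Finset.range n).filter (· ∈ s)).card := by simp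
    _ ≤ M ^ s.ncard := by
        refine pow_le_pow_right₀ hM ?_
        rw [← Set.ncard_coe_finset]
        refine Set.ncard_le_ncard (fun i hi => ?_) hs
        simp at hi
        exact hi.2

theorem finprod_mem_nonneg' {s : Set ℕ} {a : ℕ → ℝ} (h0 : ∀ i, 0 ≤ a i) : 0 ≤ ∏ᶠ i ∈ s, a i :=
  finprod_mem_induction (p := fun x : ℝ => 0 ≤ x) zero_le_one (fun _ _ => mul_nonneg)
    (fun i _ => h0 i)

open Classical in
theorem finprod_mem_le_pow {s : Set ℕ} (hs : s.Finite) {a : ℕ → ℝ} {M : ℝ} (hM : 1 ≤ M)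
    (h0 : ∀ i, 0 ≤ a i) (hle : ∀ i, a i ≤ M) : ∏ᶠ i ∈ s, a i ≤ M ^ s.ncard := by
  obtain ⟨n, hn⟩ := (prod_range_ite_eventually_eq hs a).exists
  rw [← hn]
  exact prod_range_ite_le_pow hs hM h0 hle n

theorem tendsto_finprod_mem {s : Set ℕ} (hs : s.Finite) {a : ℕ → ℕ → ℝ} {b : ℕ → ℝ}
    (h : ∀ i, Tendsto (fun n => a n i) atTop (𝓝 (b i))) :
    Tendsto (fun n => ∏ᶠ i ∈ s, a n i) atTop (𝓝 (∏ᶠ i ∈ s, b i)) := by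
  simp only [finprod_mem_eq_finite_toFinset_prod _ hs]
  exact tendsto_finsetProd _ (fun i _ => h i)

end FinProd

/-- The generating function of the Poisson law, summed from the exponential series. Integrability
for large c supplies the dominating functions used below; the value of `toNat` at ⊤ is immaterial,
as ⊤ carries no mass. -/
theorem integral_pow_poisson (r : NNReal) (c : ℝ) :
    Integrable (fun n : ℕ∞ => c ^ n.toNat) ((poissonMeasure r).map (Nat.cast : ℕ → ℕ∞)) ∧
    ∫ n, c ^ n.toNat ∂((poissonMeasure r).map (Nat.cast : ℕ → ℕ∞)) = Real.exp ((c - 1) * r) := by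
  have hs : ∀ x : ℝ, HasSum (fun n : ℕ => Real.exp (-r) * r ^ n / n.factorial * x ^ n)
      (Real.exp ((x - 1) * r)) := by
    intro x
    have := (NormedSpace.expSeries_div_hasSum_exp (r * x : ℝ)).mul_left (Real.exp (-r))
    rw [← Real.exp_eq_exp_ℝ, ← Real.exp_add] at this
    convert! this using 1
    · ext n
      rw [mul_pow]; ring
    · congr 1; ring
  constructor
  · rw [integrable_map_measure .of_discrete .of_discrete, integrable_poissonMeasure_iff]
    simpa using (hs |c|).summable
  · rw [integral_map .of_discrete .of_discrete, integral_poissonMeasure]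
    simpa using (hs c).tsum_eq

/-! ### Laplace functionals of Poisson processes -/

section Laplace

variable {Ω E : Type*} [MeasurableSpace Ω] [MeasurableSpace E] {μ : Measure Ω}
  {ν : Measure E} {X : ℕ → Ω → E} {I : Ω → Set ℕ} {B : Set E}

theorem IsPoissonProcess.ae_finite (h : IsPoissonProcess μ ν X I) (hB : MeasurableSet B)
    (hνB : ν B ≠ ∞) : ∀ᵐ ω ∂μ, (presentIn X I B ω).Finite := by
  have h1 : ∀ᵐ n ∂((poissonMeasure (ν B).toNNReal).map (Nat.cast : ℕ → ℕ∞)), n ≠ ⊤ := by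
    rw [ae_map_iff .of_discrete .of_discrete]
    simp
  rw [← (h.hasLaw_count B hB hνB).ae_iff (p := fun n => n ≠ ⊤) .of_discrete] at h1
  filter_upwards [h1] with ω hω
  exact Set.encard_ne_top_iff.mp hω

theorem IsPoissonProcess.integral_pow (h : IsPoissonProcess μ ν X I) (hB : MeasurableSet B)
    (hνB : ν B ≠ ∞) (c : ℝ) :
    Integrable (fun ω => c ^ (presentIn X I B ω).ncard) μ ∧
    ∫ ω, c ^ (presentIn X I B ω).ncard ∂μ = Real.exp ((c - 1) * ν.real B) := by
  have hl := h.hasLaw_count B hB hνB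
  obtain ⟨h1, h2⟩ := integral_pow_poisson (ν B).toNNReal c
  rw [← hl.map_eq] at h1 h2
  rw [integrable_map_measure .of_discrete hl.aemeasurable] at h1
  rw [integral_map hl.aemeasurable .of_discrete] at h2
  exact ⟨h1, h2⟩

open Classical in
theorem IsPoissonProcess.measurable_ite (h : IsPoissonProcess μ ν X I) (hB : MeasurableSet B)
    {b : ℕ → Ω → ℝ} (hb : ∀ i, Measurable (b i)) (n : ℕ) :
    Measurable (fun ω => ∏ i ∈ Finset.range n, if i ∈ presentIn X I B ω then b i ω else 1) := by
  refine Finset.measurable_fun_prod _ (fun i _ => ?_)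
  refine Measurable.ite ?_ (hb i) measurable_const
  exact (h.measurableSet_index i).inter (h.measurable_point i hB)

theorem IsPoissonProcess.aemeasurable_finprod (h : IsPoissonProcess μ ν X I)
    (hB : MeasurableSet B) (hνB : ν B ≠ ∞) {b : ℕ → Ω → ℝ} (hb : ∀ i, Measurable (b i)) :
    AEMeasurable (fun ω => ∏ᶠ i ∈ presentIn X I B ω, b i ω) μ := by
  classical
  refine aemeasurable_of_tendsto_metrizable_ae atTop
    (f := fun n ω => ∏ i ∈ Finset.range n, if i ∈ presentIn X I B ω then b i ω else 1)
    (fun n => (h.measurable_ite hB hb n).aemeasurable) ?_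
  filter_upwards [h.ae_finite hB hνB] with ω hω
  exact tendsto_nhds_of_eventually_eq (prod_range_ite_eventually_eq hω _)

/-- Grouping the points by the value of f turns the product into powers c^(number of points in the
level set of c). The level sets are disjoint, so the counts are independent and the expectation is a
product of Poisson generating functions. -/
theorem IsPoissonProcess.integral_finprod_simpleFunc (h : IsPoissonProcess μ ν X I)
    (hB : MeasurableSet B) (hνB : ν B ≠ ∞) (f : SimpleFunc E ℝ) :
    ∫ ω, ∏ᶠ i ∈ presentIn X I B ω, f (X i ω) ∂μ = Real.exp (∫ p in B, (f p - 1) ∂ν) := by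
  classical
  have : IsFiniteMeasure (ν.restrict B) := isFiniteMeasure_restrict.mpr hνB
  set A : ℝ → Set E := fun c => B ∩ f ⁻¹' {c} with hA
  have hAm : ∀ c, MeasurableSet (A c) := fun c => hB.inter (f.measurableSet_fiber c)
  have hAfin : ∀ c, ν (A c) ≠ ∞ := fun c => measure_ne_top_of_subset Set.inter_subset_left hνB
  have hdisj : Pairwise (Function.onFun Disjoint A) := by
    intro a b hab
    refine Set.disjoint_left.mpr ?_
    rintro x ⟨_, hx⟩ ⟨_, hy⟩
    exact hab (by rw [← (show f x = a from hx), ← (show f x = b from hy)])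
  have h1 : ∀ᵐ ω ∂μ, ∏ᶠ i ∈ presentIn X I B ω, f (X i ω)
      = ∏ j : Fin f.range.card, ((f.range.equivFin.symm j : ℝ)) ^
          (presentIn X I (A (f.range.equivFin.symm j)) ω).ncard := by
    filter_upwards [h.ae_finite hB hνB] with ω hω
    rw [f.range.equivFin.symm.prod_comp
      (fun c : f.range => (c : ℝ) ^ (presentIn X I (A c) ω).ncard),
      Finset.prod_coe_sort f.range (fun c => (c : ℝ) ^ (presentIn X I (A c) ω).ncard),
      finprod_mem_eq_finite_toFinset_prod _ hω,
      ← Finset.prod_fiberwise_of_maps_to (s := hω.toFinset) (t := f.range)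
        (g := fun i => f (X i ω)) (fun i _ => f.mem_range_self _)]
    refine Finset.prod_congr rfl (fun c _ => ?_)
    rw [Finset.prod_congr rfl (g := fun _ => c)
      (fun i hi => (Finset.mem_filter.mp hi).2), Finset.prod_const]
    congr 1
    rw [← Set.ncard_coe_finset]
    congr 1
    ext i
    simp [presentIn, hA, and_assoc]
  rw [integral_congr_ae h1]
  have hind := (h.indep_count f.range.card (fun j => A (f.range.equivFin.symm j))
    (fun j => hAm _) (fun i j hij => hdisj (by
      intro hc
      exact hij (f.range.equivFin.symm.injective (Subtype.ext hc))))).comp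
    (fun j (n : ℕ∞) => ((f.range.equivFin.symm j : ℝ)) ^ n.toNat) (fun j => .of_discrete)
  have h2 := hind.integral_fun_prod_eq_prod_integral
    (fun j => ((h.integral_pow (hAm _) (hAfin _) _).1.aestronglyMeasurable))
  refine h2.trans ?_
  refine (Finset.prod_congr rfl (fun j _ => (h.integral_pow (hAm _) (hAfin _) _).2)).trans ?_
  rw [f.range.equivFin.symm.prod_comp
      (fun c : f.range => Real.exp (((c : ℝ) - 1) * ν.real (A c))),
    Finset.prod_coe_sort f.range (fun c => Real.exp ((c - 1) * ν.real (A c))),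
    ← Real.exp_sum]
  congr 1
  have hi := SimpleFunc.integrable_of_isFiniteMeasure (μ := ν.restrict B) f
  have e1 : ∑ c ∈ f.range, (ν.restrict B).real (f ⁻¹' {c}) = (ν.restrict B).real Set.univ := by
    have := f.sum_range_measure_preimage_singleton (ν.restrict B)
    simp only [measureReal_def]
    rw [← this, ENNReal.toReal_sum (fun _ _ => measure_ne_top _ _)]
  rw [integral_sub hi (integrable_const _), f.integral_eq_sum hi, integral_const, ← e1]
  simp only [smul_eq_mul, mul_one, ← Finset.sum_sub_distrib]
  refine Finset.sum_congr rfl (fun c _ => ?_)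
  rw [measureReal_restrict_apply (f.measurableSet_fiber c), Set.inter_comm]
  ring

/-- The Laplace functional of a Poisson process. -/
theorem IsPoissonProcess.integral_finprod (h : IsPoissonProcess μ ν X I)
    (hB : MeasurableSet B) (hνB : ν B ≠ ∞) {f : E → ℝ} (hf : Measurable f) {M : ℝ} (hM : 1 ≤ M)
    (h0 : ∀ p, 0 ≤ f p) (hle : ∀ p, f p ≤ M) :
    ∫ ω, ∏ᶠ i ∈ presentIn X I B ω, f (X i ω) ∂μ = Real.exp (∫ p in B, (f p - 1) ∂ν) := by
  have : IsFiniteMeasure (ν.restrict B) := isFiniteMeasure_restrict.mpr hνB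
  have hmem : (0 : ℝ) ∈ Set.Icc 0 M := ⟨le_rfl, by linarith⟩
  -- The approximants stay in [0, M], so M^(number of points in B), integrable by `integral_pow`,
  -- dominates all the products.
  set g : ℕ → SimpleFunc E ℝ := fun n => SimpleFunc.approxOn f hf (Set.Icc 0 M) 0 hmem n
  have hg : ∀ n p, g n p ∈ Set.Icc 0 M := fun n p => SimpleFunc.approxOn_mem hf hmem n p
  have hlim : ∀ p, Tendsto (fun n => g n p) atTop (𝓝 (f p)) := fun p =>
    SimpleFunc.tendsto_approxOn hf hmem (subset_closure ⟨h0 p, hle p⟩)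
  have hL : Tendsto (fun n => ∫ ω, ∏ᶠ i ∈ presentIn X I B ω, g n (X i ω) ∂μ) atTop
      (𝓝 (∫ ω, ∏ᶠ i ∈ presentIn X I B ω, f (X i ω) ∂μ)) := by
    refine tendsto_integral_of_dominated_convergence
      (fun ω => M ^ (presentIn X I B ω).ncard) ?_ (h.integral_pow hB hνB M).1 ?_ ?_
    · intro n
      exact (h.aemeasurable_finprod hB hνB
        (fun i => (g n).measurable.comp (h.measurable_point i))).aestronglyMeasurable
    · intro n
      filter_upwards [h.ae_finite hB hνB] with ω hω
      rw [Real.norm_of_nonneg (finprod_mem_nonneg' (fun i => (hg n _).1))]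
      exact finprod_mem_le_pow hω hM (fun i => (hg n _).1) (fun i => (hg n _).2)
    · filter_upwards [h.ae_finite hB hνB] with ω hω
      exact tendsto_finprod_mem hω (fun i => hlim _)
  have hR : Tendsto (fun n => Real.exp (∫ p in B, (g n p - 1) ∂ν)) atTop
      (𝓝 (Real.exp (∫ p in B, (f p - 1) ∂ν))) := by
    refine (Real.continuous_exp.tendsto _).comp ?_
    refine tendsto_integral_of_dominated_convergence (fun _ => M + 1) ?_ (integrable_const _) ?_ ?_
    · intro n
      exact ((g n).measurable.sub_const 1).aestronglyMeasurable
    · intro n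
      refine Eventually.of_forall (fun p => ?_)
      rw [Real.norm_eq_abs, abs_le]
      have := hg n p
      exact ⟨by linarith [this.1], by linarith [this.2]⟩
    · exact Eventually.of_forall (fun p => (hlim p).sub_const 1)
  refine tendsto_nhds_unique hL ?_
  simpa only [h.integral_finprod_simpleFunc hB hνB] using hR

variable {F : Type*} [MeasurableSpace F] {Q : Measure F} {C : ℕ → Ω → F}

/-- The Laplace functional of an independently marked Poisson process. -/
theorem IsPoissonProcess.integral_finprod_marked [IsProbabilityMeasure μ]
    (h : IsPoissonProcess μ ν X I)
    (hC : ∀ i, Measurable (C i)) (hlaw : ∀ i, HasLaw (C i) Q μ) (hind : iIndepFun C μ)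
    (hCX : IndepFun (fun ω i => C i ω) (fun ω i => ((X i ω, i ∈ I ω) : E × Prop)) μ)
    (hB : MeasurableSet B) (hνB : ν B ≠ ∞) {g : F → E → ℝ} (hg : Measurable (Function.uncurry g))
    {M : ℝ} (hM : 1 ≤ M) (h0 : ∀ F p, 0 ≤ g F p) (hle : ∀ F p, g F p ≤ M) :
    ∫ ω, ∏ᶠ i ∈ presentIn X I B ω, g (C i ω) (X i ω) ∂μ
      = Real.exp (∫ p in B, (∫ F, g F p ∂Q - 1) ∂ν) := by
  classical
  have : IsProbabilityMeasure Q := (hlaw 0).isProbabilityMeasure_iff.mp inferInstance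
  have hgi : ∀ p, Integrable (fun F => g F p) Q := fun p =>
    Integrable.of_bound (C := M) (hg.comp measurable_prodMk_right).aestronglyMeasurable
      (Eventually.of_forall fun F => by rw [Real.norm_of_nonneg (h0 _ _)]; exact hle _ _)
  set G : E → ℝ := fun p => ∫ F, g F p ∂Q with hG
  have hGm : Measurable G :=
    (StronglyMeasurable.integral_prod_left (f := g) hg.stronglyMeasurable).measurable
  have hG0 : ∀ p, 0 ≤ G p := fun p => integral_nonneg (fun F => h0 _ _)
  have hGle : ∀ p, G p ≤ M := fun p => by
    calc G p ≤ ∫ F, M ∂Q := integral_mono (hgi p) (integrable_const _) (fun F => hle _ _)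
      _ = M := by simp
  have hgm : ∀ i, Measurable (fun ω => g (C i ω) (X i ω)) := fun i =>
    hg.comp ((hC i).prodMk (h.measurable_point i))
  have hbm : ∀ i, Measurable (fun ω => G (X i ω)) := fun i => hGm.comp (h.measurable_point i)
  -- It remains to show that each mark may be averaged out, i.e. that g (C i) (X i) may be replaced
  -- by G (X i). This is checked for the products over i < n, which converge under domination.
  rw [← h.integral_finprod hB hνB hGm hM hG0 hGle]
  have lim : ∀ b : ℕ → Ω → ℝ, (∀ i, Measurable (b i)) → (∀ i ω, 0 ≤ b i ω) → (∀ i ω, b i ω ≤ M) →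
      Tendsto (fun n => ∫ ω, ∏ i ∈ Finset.range n,
        (if i ∈ presentIn X I B ω then b i ω else 1) ∂μ) atTop
        (𝓝 (∫ ω, ∏ᶠ i ∈ presentIn X I B ω, b i ω ∂μ)) := by
    intro b hb hb0 hb1
    refine tendsto_integral_of_dominated_convergence
      (fun ω => M ^ (presentIn X I B ω).ncard) ?_ (h.integral_pow hB hνB M).1 ?_ ?_
    · exact fun n => (h.measurable_ite hB hb n).aestronglyMeasurable
    · intro n
      filter_upwards [h.ae_finite hB hνB] with ω hω
      rw [Real.norm_of_nonneg (Finset.prod_nonneg (fun i _ => by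
        split_ifs
        exacts [hb0 _ _, zero_le_one]))]
      exact prod_range_ite_le_pow hω hM (fun i => hb0 _ _) (fun i => hb1 _ _) n
    · filter_upwards [h.ae_finite hB hνB] with ω hω
      exact tendsto_nhds_of_eventually_eq (prod_range_ite_eventually_eq hω _)
  refine tendsto_nhds_unique (lim _ hgm (fun _ _ => h0 _ _) (fun _ _ => hle _ _)) ?_
  refine (lim _ hbm (fun _ _ => hG0 _) (fun _ _ => hGle _)).congr (fun n => ?_)
  -- independence of the marks and the points
  set Y : Ω → ℕ → E × Prop := fun ω i => (X i ω, i ∈ I ω)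
  have hYm : Measurable Y := measurable_pi_lambda _ (fun i =>
    (h.measurable_point i).prodMk (measurableSet_setOfPred.mp (h.measurableSet_index i)))
  have hCm : Measurable (fun ω i => C i ω) := measurable_pi_lambda _ hC
  have hPm : ∀ i, MeasurableSet {y : ℕ → E × Prop | (y i).2 ∧ (y i).1 ∈ B} := fun i => by
    refine MeasurableSet.inter ?_ (measurable_fst.comp (measurable_pi_apply i) hB)
    exact measurableSet_setOfPred.mpr (measurable_snd.comp (measurable_pi_apply i))
  set Φ : (ℕ → F) × (ℕ → E × Prop) → ℝ := fun z => ∏ i ∈ Finset.range n,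
    if i ∈ {i | (z.2 i).2 ∧ (z.2 i).1 ∈ B} then g (z.1 i) (z.2 i).1 else 1
  have hΦm : Measurable Φ := by
    refine Finset.measurable_fun_prod _ (fun i _ => ?_)
    refine Measurable.ite (measurable_snd (hPm i)) ?_ measurable_const
    have m1 : Measurable (fun z : (ℕ → F) × (ℕ → E × Prop) => z.1 i) := by fun_prop
    have m2 : Measurable (fun z : (ℕ → F) × (ℕ → E × Prop) => (z.2 i).1) := by fun_prop
    exact hg.comp (m1.prodMk m2)
  have hΦb : ∀ z, ‖Φ z‖ ≤ M ^ n := by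
    intro z
    rw [Real.norm_of_nonneg (Finset.prod_nonneg (fun i _ => by
        split_ifs
        exacts [h0 _ _, zero_le_one]))]
    calc Φ z ≤ ∏ i ∈ Finset.range n, M := Finset.prod_le_prod (fun i _ => by
          split_ifs
          exacts [h0 _ _, zero_le_one]) (fun i _ => by
          split_ifs
          exacts [hle _ _, hM])
      _ = M ^ n := by simp
  have hjoint := hCX.map_prod_eq_prod_map_map hCm.aemeasurable hYm.aemeasurable
  have := Measure.isProbabilityMeasure_map (μ := μ) hCm.aemeasurable
  have := Measure.isProbabilityMeasure_map (μ := μ) hYm.aemeasurable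
  have e1 : ∫ ω, ∏ i ∈ Finset.range n,
        (if i ∈ presentIn X I B ω then g (C i ω) (X i ω) else 1) ∂μ
      = ∫ z, Φ z ∂(μ.map (fun ω => ((fun i => C i ω), Y ω))) := by
    rw [integral_map (hCm.prodMk hYm).aemeasurable hΦm.aestronglyMeasurable]
    refine integral_congr_ae (Eventually.of_forall fun ω => Finset.prod_congr rfl fun i _ => ?_)
    congr
  -- Fubini with the points frozen: the inner integral is over the independent marks only and
  -- factorizes.
  rw [e1, hjoint, integral_prod_symm _ (Integrable.of_bound hΦm.aestronglyMeasurable _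
    (Eventually.of_forall hΦb)), integral_map hYm.aemeasurable
    (StronglyMeasurable.integral_prod_left (f := fun x y => Φ (x, y))
      hΦm.stronglyMeasurable).aestronglyMeasurable]
  refine integral_congr_ae (Eventually.of_forall fun ω => ?_)
  dsimp only
  rw [integral_map hCm.aemeasurable (f := fun x => Φ (x, Y ω))
    (hΦm.comp measurable_prodMk_right).aestronglyMeasurable]
  have hi := ((hind.comp (fun i c => if i ∈ presentIn X I B ω then g c (X i ω) else 1)
    (fun i => by
      split_ifs
      exacts [hg.comp measurable_prodMk_right, measurable_const])).precomp
    (g := fun j : Fin n => (j : ℕ)) Fin.val_injective).integral_fun_prod_eq_prod_integral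
    (fun j => by
      dsimp only [Function.comp_def]
      split_ifs
      exacts [((hg.comp measurable_prodMk_right).comp (hC _)).aestronglyMeasurable,
        aestronglyMeasurable_const])
  have e2 : ∀ ω', Φ ((fun i => C i ω'), Y ω) = ∏ j : Fin n,
      ((fun c => if (j : ℕ) ∈ presentIn X I B ω then g c (X j ω) else 1) ∘ C j) ω' := by
    intro ω'
    refine (Finset.prod_range _).trans (Finset.prod_congr rfl fun j _ => ?_)
    dsimp only [Function.comp_def]
    congr
  simp only [e2]
  rw [hi, ← Fin.prod_univ_eq_prod_range]
  refine Finset.prod_congr rfl (fun j _ => ?_)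
  by_cases hj : (j : ℕ) ∈ presentIn X I B ω
  · simp only [Function.comp_def, hj, if_true]
    simp only [hG]
    rw [← (hlaw j).map_eq, integral_map (hC j).aemeasurable (f := fun F => g F (X j ω))
      (hg.comp measurable_prodMk_right).aestronglyMeasurable]
  · simp [hj]

end Laplace

/-! ### Measurability of distance and membership for random closed sets -/

section Closeds

variable {E : Type*} [MetricSpace E] [ProperSpace E]

/-- The distance from x to F is below r exactly when F hits some closed ball around x of rational
radius below r. Such balls are compact in a proper space, so these are countably many generators of
the σ-algebra. -/
theorem measurable_infEDist_closeds (x : E) :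
    Measurable (fun F : Closeds E => Metric.infEDist x (F : Set E)) := by
  refine measurable_of_Iio (fun r => ?_)
  have : (fun F : Closeds E => Metric.infEDist x (F : Set E)) ⁻¹' Set.Iio r
      = ⋃ q ∈ {q : ℚ | ((Real.toNNReal q : NNReal) : ℝ≥0∞) < r},
        {F : Closeds E | ((F : Set E) ∩ Metric.closedBall x (Real.toNNReal q)).Nonempty} := by
    ext F
    simp only [Set.mem_preimage, Set.mem_Iio, Metric.infEDist_lt_iff, Set.mem_iUnion,
      Set.mem_ofPred_eq, exists_prop]
    constructor
    · rintro ⟨y, hy, hxy⟩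
      obtain ⟨q, _, hq1, hq2⟩ := ENNReal.lt_iff_exists_rat_btwn.mp hxy
      refine ⟨q, hq2, y, hy, ?_⟩
      rw [Metric.mem_closedBall']
      rw [edist_nndist, ENNReal.coe_lt_coe] at hq1
      exact_mod_cast hq1.le
    · rintro ⟨q, hq, y, hy, hxy⟩
      refine ⟨y, hy, lt_of_le_of_lt ?_ hq⟩
      rw [Metric.mem_closedBall'] at hxy
      rw [edist_nndist, ENNReal.coe_le_coe]
      exact_mod_cast hxy
  rw [this]
  refine MeasurableSet.biUnion (Set.to_countable _) (fun q _ => ?_)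
  exact MeasurableSpace.measurableSet_generateFrom ⟨_, isCompact_closedBall _ _, rfl⟩

variable [MeasurableSpace E] [BorelSpace E]

theorem measurable_infEDist_prod :
    Measurable (fun z : Closeds E × E => Metric.infEDist z.2 (z.1 : Set E)) := by
  have := measurable_uncurry_of_continuous_of_measurable
    (u := fun (x : E) (F : Closeds E) => Metric.infEDist x (F : Set E))
    (fun F => Metric.continuous_infEDist) measurable_infEDist_closeds
  exact this.comp measurable_swap

theorem measurableSet_mem_cthickening (r : ℝ) :
    MeasurableSet {z : Closeds E × E | z.2 ∈ Metric.cthickening r (z.1 : Set E)} :=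
  measurable_infEDist_prod measurableSet_Iic

theorem measurableSet_mem_closeds : MeasurableSet {z : Closeds E × E | z.2 ∈ (z.1 : Set E)} := by
  convert measurableSet_mem_cthickening (E := E) 0 using 3
  rename_i z
  rw [Metric.cthickening_zero, z.1.isClosed.closure_eq]

end Closeds

/-! ### The weight 2^(-N) -/

/-- `(1 / 2) ^ N`, read as `0` at infinity. -/
noncomputable def halfPow (N : ℕ∞) : ℝ := if N = ⊤ then 0 else (1 / 2) ^ N.toNat

theorem halfPow_nonneg (N : ℕ∞) : 0 ≤ halfPow N := by
  unfold halfPow; split_ifs <;> positivity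

theorem halfPow_le_one (N : ℕ∞) : halfPow N ≤ 1 := by
  unfold halfPow
  split_ifs
  · exact zero_le_one
  · exact pow_le_one₀ (by norm_num) (by norm_num)

open Classical in
-- The value 0 at ⊤ is what makes this hold for infinite s as well. Hence the weight is jointly
-- measurable in (ω, x) with no exceptional set to discard.
theorem tendsto_prod_halfPow (s : Set ℕ) :
    Tendsto (fun n => ∏ i ∈ Finset.range n, (if i ∈ s then (1 / 2 : ℝ) else 1)) atTop
      (𝓝 (halfPow s.encard)) := by
  by_cases hs : s.Finite
  · refine tendsto_nhds_of_eventually_eq ?_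
    filter_upwards [prod_range_ite_eventually_eq hs (fun _ => 1 / 2)] with n hn
    rw [hn, finprod_mem_eq_finite_toFinset_prod _ hs, Finset.prod_const, halfPow,
      if_neg (Set.encard_ne_top_iff.mpr hs), ← Set.ncard_def, Set.ncard_eq_toFinset_card s hs]
  · have hinf : s.Infinite := hs
    rw [halfPow, if_pos (Set.encard_eq_top_iff.mpr hinf)]
    have : ∀ n, ∏ i ∈ Finset.range n, (if i ∈ s then (1 / 2 : ℝ) else 1)
        = (1 / 2) ^ ((Finset.range n).filter (· ∈ s)).card := by
      intro n
      rw [← Finset.prod_filter, Finset.prod_const]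
    simp only [this]
    refine (tendsto_pow_atTop_nhds_zero_of_lt_one (by norm_num) (by norm_num)).comp ?_
    refine tendsto_atTop_atTop_of_monotone (fun a b hab => ?_)
      (fun b => ⟨Nat.nth (· ∈ s) b, ?_⟩)
    · simpa only [Nat.count_eq_card_filter_range] using Nat.count_monotone (· ∈ s) hab
    · rw [← Nat.count_eq_card_filter_range]
      exact (Nat.count_nth_of_infinite (p := (· ∈ s)) hinf b).ge

/-- The indices of the sets `X i + S i`, `i ∈ I`, that contain `x`. -/
def coverIdx {E : Type*} [Add E] (I : Set ℕ) (X : ℕ → E) (S : ℕ → Set E) (x : E) : Set ℕ :=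
  {i | i ∈ I ∧ x ∈ X i +ᵥ S i}

/-! ### Second moments of integrals of random fields -/

section SecondMoment

/-- A second moment bound for the integral of a random field whose values outside a set `D` of
pairs are uncorrelated. -/
theorem integral_sq_integral_sub_le {Ω E : Type*} [MeasurableSpace Ω] [MeasurableSpace E]
    (μ : Measure Ω) [IsProbabilityMeasure μ] (ν : Measure E) [IsFiniteMeasure ν] {T : Ω → E → ℝ}
    (hTm : Measurable (fun w : Ω × E => T w.1 w.2)) (hT0 : ∀ ω x, 0 ≤ T ω x)
    (hT1 : ∀ ω x, T ω x ≤ 1) {m : ℝ} (hm0 : 0 ≤ m) (hm1 : m ≤ 1) (hm : ∀ x, ∫ ω, T ω x ∂μ = m)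
    {D : Set (E × E)} (hD : MeasurableSet D)
    (hmm : ∀ x y, (x, y) ∉ D → ∫ ω, T ω x * T ω y ∂μ = m ^ 2) :
    Integrable (fun ω => (∫ x, T ω x ∂ν - ν.real Set.univ * m) ^ 2) μ ∧
    ∫ ω, (∫ x, T ω x ∂ν - ν.real Set.univ * m) ^ 2 ∂μ ≤ (ν.prod ν).real D := by
  have hub : ∀ ω x y, |(T ω x - m) * (T ω y - m)| ≤ 1 := by
    intro ω x y
    have h : ∀ x, |T ω x - m| ≤ 1 := fun x => by
      rw [abs_le]; constructor <;> linarith [hT0 ω x, hT1 ω x]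
    rw [abs_mul]
    exact mul_le_one₀ (h x) (abs_nonneg _) (h y)
  have hTi : ∀ ω, Integrable (T ω) ν := fun ω =>
    Integrable.of_bound (hTm.comp measurable_prodMk_left).aestronglyMeasurable 1
      (Eventually.of_forall fun x => by rw [Real.norm_of_nonneg (hT0 _ _)]; exact hT1 _ _)
  have hTi' : ∀ x, Integrable (fun ω => T ω x) μ := fun x =>
    Integrable.of_bound (hTm.comp measurable_prodMk_right).aestronglyMeasurable 1
      (Eventually.of_forall fun x => by rw [Real.norm_of_nonneg (hT0 _ _)]; exact hT1 _ _)
  have hjm : Measurable (fun w : Ω × (E × E) => (T w.1 w.2.1 - m) * (T w.1 w.2.2 - m)) := by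
    have h1 : Measurable (fun w : Ω × (E × E) => T w.1 w.2.1) :=
      hTm.comp (by fun_prop : Measurable (fun w : Ω × (E × E) => (w.1, w.2.1)))
    have h2 : Measurable (fun w : Ω × (E × E) => T w.1 w.2.2) :=
      hTm.comp (by fun_prop : Measurable (fun w : Ω × (E × E) => (w.1, w.2.2)))
    exact (h1.sub_const m).mul (h2.sub_const m)
  have e1 : ∀ ω, (∫ x, T ω x ∂ν - ν.real Set.univ * m) ^ 2
      = ∫ w, (T ω w.1 - m) * (T ω w.2 - m) ∂(ν.prod ν) := by
    intro ω
    rw [integral_prod_mul (fun x => T ω x - m) (fun x => T ω x - m),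
      integral_sub (hTi ω) (integrable_const _), integral_const, smul_eq_mul, pow_two]
  have hji : Integrable (Function.uncurry fun (ω : Ω) (w : E × E) => (T ω w.1 - m) * (T ω w.2 - m))
      (μ.prod (ν.prod ν)) :=
    Integrable.of_bound hjm.aestronglyMeasurable 1 (Eventually.of_forall fun w => hub _ _ _)
  simp only [e1]
  refine ⟨hji.integral_prod_left, ?_⟩
  rw [integral_integral_swap hji]
  -- The covariance vanishes off D and is at most 1 on D.
  have hle : ∀ w : E × E, ∫ ω, (T ω w.1 - m) * (T ω w.2 - m) ∂μ ≤ D.indicator (fun _ => 1) w := by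
    intro w
    have hint : Integrable (fun ω => (T ω w.1 - m) * (T ω w.2 - m)) μ :=
      Integrable.of_bound (hjm.comp measurable_prodMk_right).aestronglyMeasurable 1
        (Eventually.of_forall fun ω => hub _ _ _)
    by_cases hw : w ∈ D
    · rw [Set.indicator_of_mem hw]
      calc _ ≤ ∫ ω, (1 : ℝ) ∂μ := integral_mono hint (integrable_const _)
            (fun ω => (abs_le.mp (hub ω w.1 w.2)).2)
        _ = 1 := by simp
    · rw [Set.indicator_of_notMem hw]
      have hTT : Integrable (fun ω => T ω w.1 * T ω w.2) μ := by
        refine Integrable.of_bound ((hTi' _).aestronglyMeasurable.mul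
          (hTi' _).aestronglyMeasurable) 1 (Eventually.of_forall fun ω => ?_)
        rw [Real.norm_of_nonneg (mul_nonneg (hT0 _ _) (hT0 _ _))]
        exact mul_le_one₀ (hT1 _ _) (hT0 _ _) (hT1 _ _)
      have e2 : ∀ ω, (T ω w.1 - m) * (T ω w.2 - m)
          = T ω w.1 * T ω w.2 - m * T ω w.1 - m * T ω w.2 + m ^ 2 := fun ω => by ring
      simp only [e2]
      have i1 := (hTi' w.1).const_mul m
      have i2 := (hTi' w.2).const_mul m
      rw [integral_add (by exact (hTT.sub i1).sub i2) (integrable_const _),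
        integral_sub (by exact hTT.sub i1) i2, integral_sub hTT i1, integral_const_mul,
        integral_const_mul, hm w.1, hm w.2, hmm w.1 w.2 hw, integral_const, probReal_univ, one_smul]
      exact le_of_eq (by ring)
  calc _ ≤ ∫ w, D.indicator (fun _ => (1 : ℝ)) w ∂(ν.prod ν) :=
        integral_mono hji.integral_prod_right ((integrable_const _).indicator hD) hle
    _ = (ν.prod ν).real D := by rw [integral_indicator_const _ hD, smul_eq_mul, mul_one]

end SecondMoment

/-! ### Moments and variances of the cover weight -/

section Model

variable {Ω : Type*} [MeasurableSpace Ω] {d : ℕ} {μ : Measure Ω}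
  {lam : ℝ} {Q : Measure (Closeds (EuclideanSpace ℝ (Fin d)))}
  {X : ℕ → Ω → EuclideanSpace ℝ (Fin d)} {I : Ω → Set ℕ}
  {C : ℕ → Ω → Closeds (EuclideanSpace ℝ (Fin d))}

local notation "𝔼" => EuclideanSpace ℝ (Fin d)

theorem mem_vadd_smul_iff {E : Type*} [AddCommGroup E] [Module ℝ E] {δ : ℝ} (hδ : 0 < δ)
    (x p : E) (F : Set E) :
    x ∈ p +ᵥ δ • F ↔ δ⁻¹ • (x - p) ∈ F := by
  rw [Set.mem_vadd_set_iff_neg_vadd_mem, Set.mem_smul_set_iff_inv_smul_mem₀ hδ.ne', vadd_eq_add,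
    neg_add_eq_sub]

/-- The indicator-type factor `z` when `p + δ F` covers `x`, and `1` otherwise. -/
noncomputable def coverFactor (δ z : ℝ) (x : 𝔼) (F : Closeds 𝔼) (p : 𝔼) : ℝ :=
  open Classical in if δ⁻¹ • (x - p) ∈ (F : Set 𝔼) then z else 1

theorem coverFactor_nonneg {δ z : ℝ} (hz : 0 ≤ z) (x : 𝔼) (F : Closeds 𝔼) (p : 𝔼) :
    0 ≤ coverFactor δ z x F p := by
  unfold coverFactor; split_ifs <;> linarith

theorem coverFactor_le_one {δ z : ℝ} (hz : z ≤ 1) (x : 𝔼) (F : Closeds 𝔼) (p : 𝔼) :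
    coverFactor δ z x F p ≤ 1 := by
  unfold coverFactor; split_ifs <;> linarith

theorem measurable_coverFactor (δ z : ℝ) (x : 𝔼) :
    Measurable (Function.uncurry (coverFactor (d := d) δ z x)) := by
  classical
  refine Measurable.ite (p := fun w : Closeds 𝔼 × 𝔼 => δ⁻¹ • (x - w.2) ∈ (w.1 : Set 𝔼)) ?_
    measurable_const measurable_const
  have : Measurable (fun w : Closeds 𝔼 × 𝔼 => (w.1, δ⁻¹ • (x - w.2))) := by fun_prop
  exact this measurableSet_mem_closeds

theorem measurable_halfPow_coverIdx (hm : IsModel μ lam Q X I C) {δ : ℝ} (hδ : 0 < δ) :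
    Measurable (fun w : Ω × 𝔼 => halfPow (coverIdx (I w.1) (fun i => X i w.1)
      (fun i => δ • (C i w.1 : Set 𝔼)) w.2).encard) := by
  classical
  refine measurable_of_tendsto_metrizable (f := fun n (w : Ω × 𝔼) => ∏ i ∈ Finset.range n,
    (if i ∈ coverIdx (I w.1) (fun i => X i w.1) (fun i => δ • (C i w.1 : Set 𝔼)) w.2
      then (1 / 2 : ℝ) else 1)) (fun n => ?_)
    (tendsto_pi_nhds.mpr fun w => tendsto_prod_halfPow _)
  refine Finset.measurable_fun_prod _ (fun i _ => ?_)
  refine Measurable.ite ?_ measurable_const measurable_const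
  simp only [coverIdx, Set.mem_ofPred_eq, mem_vadd_smul_iff hδ]
  refine MeasurableSet.inter (measurable_fst (hm.poisson.measurableSet_index i)) ?_
  have hX := hm.poisson.measurable_point i
  have hC := hm.measurable_shape i
  have : Measurable (fun w : Ω × 𝔼 => (C i w.1, δ⁻¹ • (w.2 - X i w.1))) := by fun_prop
  exact this measurableSet_mem_closeds

theorem ae_shape_subset (hm : IsModel μ lam Q X I C) {τ : ℝ}
    (hQ : ∀ᵐ F : Closeds 𝔼 ∂Q, (F : Set 𝔼) ⊆ Metric.closedBall 0 τ) :
    ∀ᵐ ω ∂μ, ∀ i, (C i ω : Set 𝔼) ⊆ Metric.closedBall 0 τ := by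
  rw [ae_all_iff]
  intro i
  rw [← (hm.hasLaw_shape i).map_eq] at hQ
  exact ae_of_ae_map (hm.measurable_shape i).aemeasurable hQ

theorem dist_le_of_mem_ball {δ τ : ℝ} (hδ : 0 < δ) {x p : 𝔼}
    (h : δ⁻¹ • (x - p) ∈ Metric.closedBall (0 : 𝔼) τ) : dist p x ≤ τ * δ := by
  rw [mem_closedBall_zero_iff, norm_smul, norm_inv, Real.norm_of_nonneg hδ.le,
    inv_mul_le_iff₀ hδ] at h
  rw [dist_comm, dist_eq_norm]
  linarith

/-- The j-th power of 2^(-N) contributes a factor 2^(-j) for each covering set. A set covering x has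
its centre within τδ of x, so only points in B contribute. -/
theorem halfPow_pow_eq_finprod {B : Set 𝔼} {δ τ : ℝ} (hδ : 0 < δ) {x : 𝔼}
    (hB : Metric.closedBall x (τ * δ) ⊆ B) {ω : Ω} (hfin : (presentIn X I B ω).Finite)
    (hC : ∀ i, (C i ω : Set 𝔼) ⊆ Metric.closedBall 0 τ) (j : ℕ) :
    halfPow (coverIdx (I ω) (fun i => X i ω) (fun i => δ • (C i ω : Set 𝔼)) x).encard ^ j
      = ∏ᶠ i ∈ presentIn X I B ω, coverFactor δ ((1 / 2) ^ j) x (C i ω) (X i ω) := by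
  classical
  refine tendsto_nhds_unique ((tendsto_prod_halfPow _).pow j) ?_
  refine tendsto_nhds_of_eventually_eq ?_
  filter_upwards [prod_range_ite_eventually_eq hfin
    (fun i => coverFactor δ ((1 / 2) ^ j) x (C i ω) (X i ω))] with n hn
  rw [← hn, ← Finset.prod_pow]
  refine Finset.prod_congr rfl (fun i _ => ?_)
  simp only [coverIdx, Set.mem_ofPred_eq, mem_vadd_smul_iff hδ, coverFactor, presentIn]
  by_cases h1 : i ∈ I ω
  · by_cases h2 : δ⁻¹ • (x - X i ω) ∈ (C i ω : Set 𝔼)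
    · have h3 : X i ω ∈ B := hB (dist_le_of_mem_ball hδ (hC i h2))
      simp [h1, h2, h3]
    · simp [h1, h2]
  · simp [h1]

variable {τ : ℝ}

theorem integrable_coverFactor [IsProbabilityMeasure Q] {δ z : ℝ} (hz0 : 0 ≤ z) (hz1 : z ≤ 1)
    (x p : 𝔼) : Integrable (fun F => coverFactor δ z x F p) Q :=
  Integrable.of_bound ((measurable_coverFactor δ z x).comp
    measurable_prodMk_right).aestronglyMeasurable 1
    (Eventually.of_forall fun F => by
      rw [Real.norm_of_nonneg (coverFactor_nonneg hz0 _ _ _)]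
      exact coverFactor_le_one hz1 _ _ _)

/-- By Fubini the shape can be fixed. The centres p for which p + δF covers x then form x - δF, a
subset of B of volume δ^d times that of F. -/
theorem setIntegral_coverFactor [IsProbabilityMeasure Q] {δ z : ℝ} (hδ : 0 < δ) (hz0 : 0 ≤ z)
    (hz1 : z ≤ 1) (hlam : 0 ≤ lam)
    (hQ : ∀ᵐ F : Closeds 𝔼 ∂Q, (F : Set 𝔼) ⊆ Metric.closedBall 0 τ) {B : Set 𝔼}
    (hBf : volume B ≠ ∞) {x : 𝔼} (hB : Metric.closedBall x (τ * δ) ⊆ B) :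
    ∫ p in B, (∫ F, coverFactor δ z x F p ∂Q - 1) ∂(ENNReal.ofReal lam • volume)
      = (z - 1) * (δ ^ d * lam * ∫ F, volume.real (F : Set 𝔼) ∂Q) := by
  have : IsFiniteMeasure (volume.restrict B) := isFiniteMeasure_restrict.mpr hBf
  have e1 : ∀ p, ∫ F, coverFactor δ z x F p ∂Q - 1 = ∫ F, (coverFactor δ z x F p - 1) ∂Q := by
    intro p
    rw [integral_sub (integrable_coverFactor hz0 hz1 x p) (integrable_const _)]
    simp
  simp only [e1]
  rw [Measure.restrict_smul, integral_smul_measure, ENNReal.toReal_ofReal hlam,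
    integral_integral_swap]
  · have e2 : ∀ᵐ F ∂Q, ∫ p in B, (coverFactor δ z x F p - 1)
        = (z - 1) * δ ^ d * volume.real (F : Set 𝔼) := by
      filter_upwards [hQ] with F hF
      have hset : {p : 𝔼 | δ⁻¹ • (x - p) ∈ (F : Set 𝔼)} = (fun p => x - p) ⁻¹' (δ • (F : Set 𝔼)) := by
        ext p
        simp [Set.mem_smul_set_iff_inv_smul_mem₀ hδ.ne']
      have hcl : IsClosed (δ • (F : Set 𝔼)) := F.isClosed.smul₀ δ
      have hmp : MeasurePreserving (fun p : 𝔼 => x - p) volume volume :=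
        Measure.measurePreserving_sub_left volume x
      have hsm : MeasurableSet {p : 𝔼 | δ⁻¹ • (x - p) ∈ (F : Set 𝔼)} := by
        rw [hset]
        exact hmp.measurable hcl.measurableSet
      have e3 : ∀ p, coverFactor δ z x F p - 1
          = Set.indicator {p : 𝔼 | δ⁻¹ • (x - p) ∈ (F : Set 𝔼)} (fun _ => z - 1) p := by
        intro p
        simp only [coverFactor, Set.indicator, Set.mem_ofPred_eq]
        split_ifs <;> simp
      simp only [e3]
      rw [integral_indicator_const _ hsm, measureReal_restrict_apply hsm,
        Set.inter_eq_left.mpr, hset, hmp.measureReal_preimage hcl.measurableSet.nullMeasurableSet,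
        measureReal_def, Measure.addHaar_smul, finrank_euclideanSpace, Fintype.card_fin,
        ENNReal.toReal_mul, ENNReal.toReal_ofReal (abs_nonneg _), abs_of_pos (pow_pos hδ d),
        smul_eq_mul, measureReal_def]
      · ring
      · intro p hp
        exact hB (dist_le_of_mem_ball hδ (hF hp))
    rw [integral_congr_ae e2, integral_const_mul, smul_eq_mul]
    ring
  · refine Integrable.of_bound (C := 1) ?_ ?_
    · exact (((measurable_coverFactor δ z x).comp measurable_swap).sub_const 1).aestronglyMeasurable
    · refine Eventually.of_forall (fun w => ?_)
      have h0 := coverFactor_nonneg (δ := δ) hz0 x w.2 w.1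
      have h1 := coverFactor_le_one (δ := δ) hz1 x w.2 w.1
      rw [Function.uncurry_apply_pair, Real.norm_eq_abs, abs_le]
      constructor <;> linarith

theorem isProbabilityMeasure_shapeLaw [IsProbabilityMeasure μ] (hm : IsModel μ lam Q X I C) :
    IsProbabilityMeasure Q :=
  (hm.hasLaw_shape 0).isProbabilityMeasure_iff.mp inferInstance

theorem smul_volume_ne_top {B : Set 𝔼} (hBf : volume B ≠ ∞) :
    (ENNReal.ofReal lam • (volume : Measure 𝔼)) B ≠ ∞ := by
  rw [Measure.smul_apply, smul_eq_mul]
  exact ENNReal.mul_ne_top ENNReal.ofReal_ne_top hBf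

/-- The weight `2 ^ (-N)`, where `N` is the number of sets that cover `x`. -/
noncomputable def coverWeight (X : ℕ → Ω → 𝔼) (I : Ω → Set ℕ) (C : ℕ → Ω → Closeds 𝔼) (δ : ℝ)
    (ω : Ω) (x : 𝔼) : ℝ :=
  halfPow (coverIdx (I ω) (fun i => X i ω) (fun i => δ • (C i ω : Set 𝔼)) x).encard

theorem integral_coverWeight_pow [IsProbabilityMeasure μ] (hm : IsModel μ lam Q X I C)
    (hlam : 0 ≤ lam) {δ : ℝ} (hδ : 0 < δ)
    (hQ : ∀ᵐ F : Closeds 𝔼 ∂Q, (F : Set 𝔼) ⊆ Metric.closedBall 0 τ) (j : ℕ) (x : 𝔼) :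
    ∫ ω, coverWeight X I C δ ω x ^ j ∂μ
      = Real.exp (((1 / 2) ^ j - 1) * (δ ^ d * lam * ∫ F, volume.real (F : Set 𝔼) ∂Q)) := by
  have := isProbabilityMeasure_shapeLaw hm
  have hz0 : (0 : ℝ) ≤ (1 / 2) ^ j := by positivity
  have hz1 : ((1 : ℝ) / 2) ^ j ≤ 1 := pow_le_one₀ (by norm_num) (by norm_num)
  have hBf : volume (Metric.closedBall x (τ * δ)) ≠ ∞ := measure_closedBall_lt_top.ne
  have hBm : MeasurableSet (Metric.closedBall x (τ * δ)) := measurableSet_closedBall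
  have key := hm.poisson.integral_finprod_marked hm.measurable_shape hm.hasLaw_shape
    hm.iIndepFun_shape hm.indepFun_shape_points hBm (smul_volume_ne_top hBf)
    (measurable_coverFactor δ ((1 / 2) ^ j) x) le_rfl
    (fun F p => coverFactor_nonneg hz0 x F p) (fun F p => coverFactor_le_one hz1 x F p)
  rw [setIntegral_coverFactor hδ hz0 hz1 hlam hQ hBf le_rfl] at key
  rw [← key]
  refine integral_congr_ae ?_
  filter_upwards [hm.poisson.ae_finite hBm (smul_volume_ne_top hBf), ae_shape_subset hm hQ]
    with ω h1 h2
  exact halfPow_pow_eq_finprod hδ le_rfl h1 h2 j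

/-- A set contained in a ball of radius τδ cannot cover two points more than 2τδ apart. At most one
of the two cover factors therefore differs from 1, their product minus 1 is the sum of the separate
deviations, and the exponent in the Laplace functional splits. -/
theorem integral_coverWeight_pow_mul [IsProbabilityMeasure μ] (hm : IsModel μ lam Q X I C)
    (hlam : 0 ≤ lam) {δ : ℝ} (hδ : 0 < δ)
    (hQ : ∀ᵐ F : Closeds 𝔼 ∂Q, (F : Set 𝔼) ⊆ Metric.closedBall 0 τ) (j : ℕ) {x y : 𝔼}
    (hxy : 2 * τ * δ < dist x y) :
    ∫ ω, coverWeight X I C δ ω x ^ j * coverWeight X I C δ ω y ^ j ∂μ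
      = Real.exp (((1 / 2) ^ j - 1) * (δ ^ d * lam * ∫ F, volume.real (F : Set 𝔼) ∂Q)) ^ 2 := by
  have := isProbabilityMeasure_shapeLaw hm
  set z : ℝ := (1 / 2) ^ j with hz
  have hz0 : 0 ≤ z := by positivity
  have hz1 : z ≤ 1 := pow_le_one₀ (by norm_num) (by norm_num)
  set B : Set 𝔼 := Metric.closedBall x (τ * δ) ∪ Metric.closedBall y (τ * δ) with hB
  have hBf : volume B ≠ ∞ :=
    (measure_union_lt_top measure_closedBall_lt_top measure_closedBall_lt_top).ne
  have hBm : MeasurableSet B := measurableSet_closedBall.union measurableSet_closedBall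
  have hf0 : ∀ x F p, 0 ≤ coverFactor (d := d) δ z x F p := coverFactor_nonneg hz0
  have hf1 : ∀ x F p, coverFactor (d := d) δ z x F p ≤ 1 := coverFactor_le_one hz1
  have key := hm.poisson.integral_finprod_marked (g := fun F p => coverFactor δ z x F p *
      coverFactor δ z y F p) hm.measurable_shape hm.hasLaw_shape
    hm.iIndepFun_shape hm.indepFun_shape_points hBm (smul_volume_ne_top hBf)
    ((measurable_coverFactor δ z x).mul (measurable_coverFactor δ z y)) le_rfl
    (fun F p => mul_nonneg (hf0 _ _ _) (hf0 _ _ _))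
    (fun F p => mul_le_one₀ (hf1 _ _ _) (hf0 _ _ _) (hf1 _ _ _))
  have e1 : ∀ p, ∫ F, coverFactor δ z x F p * coverFactor δ z y F p ∂Q - 1
      = (∫ F, coverFactor δ z x F p ∂Q - 1) + (∫ F, coverFactor δ z y F p ∂Q - 1) := by
    intro p
    have : ∫ F, coverFactor δ z x F p * coverFactor δ z y F p ∂Q
        = ∫ F, (coverFactor δ z x F p + coverFactor δ z y F p - 1) ∂Q := by
      refine integral_congr_ae ?_
      filter_upwards [hQ] with F hF
      simp only [coverFactor]
      by_cases h1 : δ⁻¹ • (x - p) ∈ (F : Set 𝔼)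
      · have h2 : ¬ δ⁻¹ • (y - p) ∈ (F : Set 𝔼) := by
          intro h2
          have h3 := dist_le_of_mem_ball hδ (hF h1)
          have h4 := dist_le_of_mem_ball hδ (hF h2)
          have := dist_triangle_left x y p
          nlinarith
        simp [h1, h2]
      · simp [h1]
    rw [this, integral_sub, integral_add]
    · simp; ring
    · exact integrable_coverFactor hz0 hz1 x p
    · exact integrable_coverFactor hz0 hz1 y p
    · exact (integrable_coverFactor hz0 hz1 x p).add (integrable_coverFactor hz0 hz1 y p)
    · exact integrable_const _
  have hνf : (ENNReal.ofReal lam • (volume : Measure 𝔼)) B ≠ ∞ := smul_volume_ne_top hBf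
  have : IsFiniteMeasure ((ENNReal.ofReal lam • (volume : Measure 𝔼)).restrict B) :=
    isFiniteMeasure_restrict.mpr hνf
  have hint : ∀ x, Integrable (fun p => ∫ F, coverFactor δ z x F p ∂Q - 1)
      ((ENNReal.ofReal lam • (volume : Measure 𝔼)).restrict B) := by
    intro x
    refine Integrable.of_bound (C := 1) ?_ (Eventually.of_forall fun p => ?_)
    · exact ((StronglyMeasurable.integral_prod_left (f := coverFactor δ z x)
        (measurable_coverFactor δ z x).stronglyMeasurable).measurable.sub_const
          1).aestronglyMeasurable
    · have h0 : 0 ≤ ∫ F, coverFactor δ z x F p ∂Q := integral_nonneg (fun F => hf0 _ _ _)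
      have h1 : ∫ F, coverFactor δ z x F p ∂Q ≤ 1 := by
        calc _ ≤ ∫ F, (1 : ℝ) ∂Q := integral_mono (integrable_coverFactor hz0 hz1 x p)
              (integrable_const _) (fun F => hf1 _ _ _)
          _ = 1 := by simp
      rw [Real.norm_eq_abs, abs_le]
      constructor <;> linarith
  simp only [e1] at key
  rw [integral_add (hint x) (hint y),
    setIntegral_coverFactor hδ hz0 hz1 hlam hQ hBf Set.subset_union_left,
    setIntegral_coverFactor hδ hz0 hz1 hlam hQ hBf Set.subset_union_right, Real.exp_add,
    ← pow_two] at key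
  rw [← key]
  refine integral_congr_ae ?_
  filter_upwards [hm.poisson.ae_finite hBm hνf, ae_shape_subset hm hQ] with ω h1 h2
  rw [finprod_mem_mul_distrib h1, coverWeight, coverWeight,
    halfPow_pow_eq_finprod hδ Set.subset_union_left h1 h2 j,
    halfPow_pow_eq_finprod hδ Set.subset_union_right h1 h2 j]

theorem coverWeight_nonneg (δ : ℝ) (ω : Ω) (x : 𝔼) : 0 ≤ coverWeight X I C δ ω x :=
  halfPow_nonneg _

theorem coverWeight_le_one (δ : ℝ) (ω : Ω) (x : 𝔼) : coverWeight X I C δ ω x ≤ 1 :=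
  halfPow_le_one _

theorem measurable_coverWeight (hm : IsModel μ lam Q X I C) {δ : ℝ} (hδ : 0 < δ) :
    Measurable (fun w : Ω × 𝔼 => coverWeight X I C δ w.1 w.2) :=
  measurable_halfPow_coverIdx hm hδ

theorem prod_restrict_dist_le {A : Set 𝔼} (hAf : volume A ≠ ∞) {δ : ℝ} (hδ : 0 ≤ δ) {r : ℝ}
    (hr : 0 ≤ r) :
    ((volume.restrict A).prod (volume.restrict A)).real {w : 𝔼 × 𝔼 | dist w.1 w.2 ≤ δ * r}
      ≤ volume.real A * (δ ^ d * volume.real (Metric.closedBall (0 : 𝔼) r)) := by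
  have : IsFiniteMeasure (volume.restrict A) := isFiniteMeasure_restrict.mpr hAf
  have hDm : MeasurableSet {w : 𝔼 × 𝔼 | dist w.1 w.2 ≤ δ * r} :=
    (isClosed_le (by fun_prop) continuous_const).measurableSet
  have hs : ∀ x : 𝔼, (volume.restrict A) (Prod.mk x ⁻¹' {w : 𝔼 × 𝔼 | dist w.1 w.2 ≤ δ * r})
      ≤ ENNReal.ofReal (δ ^ d) * volume (Metric.closedBall (0 : 𝔼) r) := by
    intro x
    have : Prod.mk x ⁻¹' {w : 𝔼 × 𝔼 | dist w.1 w.2 ≤ δ * r} = Metric.closedBall x (δ * r) := by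
      ext y
      simp [dist_comm x y]
    rw [this]
    refine (Measure.restrict_apply_le _ _).trans_eq ?_
    rw [Measure.addHaar_closedBall_mul _ _ hδ hr, finrank_euclideanSpace, Fintype.card_fin]
  have hle : ((volume.restrict A).prod (volume.restrict A)) {w : 𝔼 × 𝔼 | dist w.1 w.2 ≤ δ * r}
      ≤ volume A * (ENNReal.ofReal (δ ^ d) * volume (Metric.closedBall (0 : 𝔼) r)) := by
    rw [Measure.prod_apply hDm]
    refine (lintegral_mono hs).trans_eq ?_
    rw [lintegral_const, Measure.restrict_apply_univ, mul_comm]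
  have hfin : volume A * (ENNReal.ofReal (δ ^ d) * volume (Metric.closedBall (0 : 𝔼) r)) ≠ ∞ :=
    ENNReal.mul_ne_top hAf (ENNReal.mul_ne_top ENNReal.ofReal_ne_top
      measure_closedBall_lt_top.ne)
  refine (ENNReal.toReal_mono hfin hle).trans_eq ?_
  rw [ENNReal.toReal_mul, ENNReal.toReal_mul, ENNReal.toReal_ofReal (by positivity)]
  rfl

/-- Only pairs at distance at most 2τδ are correlated, and these have volume O(δ^d). This order
makes the variances summable along geometric intensities. -/
theorem integral_sq_sub_le [IsProbabilityMeasure μ] (hm : IsModel μ lam Q X I C) (hτ : 0 ≤ τ)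
    (hlam : 0 ≤ lam) {δ : ℝ} (hδ : 0 < δ)
    (hQ : ∀ᵐ F : Closeds 𝔼 ∂Q, (F : Set 𝔼) ⊆ Metric.closedBall 0 τ) (j : ℕ) {A : Set 𝔼}
    (hAf : volume A ≠ ∞) :
    Integrable (fun ω => ((∫ x in A, coverWeight X I C δ ω x ^ j) - volume.real A *
      Real.exp (((1 / 2) ^ j - 1) * (δ ^ d * lam * ∫ F, volume.real (F : Set 𝔼) ∂Q))) ^ 2) μ ∧
    ∫ ω, ((∫ x in A, coverWeight X I C δ ω x ^ j) - volume.real A *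
      Real.exp (((1 / 2) ^ j - 1) * (δ ^ d * lam * ∫ F, volume.real (F : Set 𝔼) ∂Q))) ^ 2 ∂μ
      ≤ volume.real A * (δ ^ d * volume.real (Metric.closedBall (0 : 𝔼) (2 * τ))) := by
  have : IsFiniteMeasure (volume.restrict A) := isFiniteMeasure_restrict.mpr hAf
  have hmle : Real.exp (((1 / 2) ^ j - 1) * (δ ^ d * lam *
      ∫ F, volume.real (F : Set 𝔼) ∂Q)) ≤ 1 := by
    rw [Real.exp_le_one_iff]
    refine mul_nonpos_of_nonpos_of_nonneg ?_ ?_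
    · linarith [pow_le_one₀ (n := j) (show (0 : ℝ) ≤ 1 / 2 by norm_num) (by norm_num)]
    · have : 0 ≤ ∫ F, volume.real (F : Set 𝔼) ∂Q := integral_nonneg (fun F => measureReal_nonneg)
      positivity
  have hDm : MeasurableSet {w : 𝔼 × 𝔼 | dist w.1 w.2 ≤ δ * (2 * τ)} :=
    (isClosed_le (by fun_prop) continuous_const).measurableSet
  have key := integral_sq_integral_sub_le μ (volume.restrict A)
    (T := fun ω x => coverWeight X I C δ ω x ^ j) ((measurable_coverWeight hm hδ).pow_const j)
    (fun ω x => pow_nonneg (coverWeight_nonneg _ _ _) _)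
    (fun ω x => pow_le_one₀ (coverWeight_nonneg _ _ _) (coverWeight_le_one _ _ _))
    (Real.exp_pos _).le hmle (integral_coverWeight_pow hm hlam hδ hQ j) hDm
    (fun x y hxy => integral_coverWeight_pow_mul hm hlam hδ hQ j (by
      have : δ * (2 * τ) < dist x y := not_le.mp hxy
      linarith))
  rw [measureReal_restrict_apply_univ] at key
  exact ⟨key.1, key.2.trans (prod_restrict_dist_le hAf hδ.le (by positivity))⟩

/-- Nonnegative random variables with summable expectations tend to zero almost surely. -/
theorem ae_tendsto_zero_of_summable_integral {Y : ℕ → Ω → ℝ} {b : ℕ → ℝ}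
    (h0 : ∀ n ω, 0 ≤ Y n ω) (hY : ∀ n, Integrable (Y n) μ) (hb : ∀ n, ∫ ω, Y n ω ∂μ ≤ b n)
    (hs : Summable b) : ∀ᵐ ω ∂μ, Tendsto (fun n => Y n ω) atTop (𝓝 0) := by
  have hm : ∀ n, AEMeasurable (fun ω => ENNReal.ofReal (Y n ω)) μ := fun n =>
    (hY n).aestronglyMeasurable.aemeasurable.ennreal_ofReal
  have hfin : ∫⁻ ω, ∑' n, ENNReal.ofReal (Y n ω) ∂μ ≠ ∞ := by
    rw [lintegral_tsum hm]
    have : ∀ n, ∫⁻ ω, ENNReal.ofReal (Y n ω) ∂μ ≤ ENNReal.ofReal (b n) := fun n => by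
      rw [← ofReal_integral_eq_lintegral_ofReal (hY n) (Eventually.of_forall fun ω => h0 n ω)]
      exact ENNReal.ofReal_le_ofReal (hb n)
    exact ne_top_of_le_ne_top hs.tsum_ofReal_ne_top (ENNReal.tsum_le_tsum this)
  filter_upwards [ae_lt_top' (AEMeasurable.tsum hm) hfin] with ω hω
  have h1 := ENNReal.tendsto_atTop_zero_of_tsum_ne_top hω.ne
  have h2 := (ENNReal.tendsto_toReal ENNReal.zero_ne_top).comp h1
  refine h2.congr (fun n => ?_)
  simp [ENNReal.toReal_ofReal (h0 n ω)]

/-- Random variables with summable second moments tend to zero almost surely. -/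
theorem ae_tendsto_zero_of_summable_integral_sq {Y : ℕ → Ω → ℝ} {b : ℕ → ℝ}
    (hY : ∀ n, Integrable (fun ω => Y n ω ^ 2) μ) (hb : ∀ n, ∫ ω, Y n ω ^ 2 ∂μ ≤ b n)
    (hs : Summable b) : ∀ᵐ ω ∂μ, Tendsto (fun n => Y n ω) atTop (𝓝 0) := by
  filter_upwards [ae_tendsto_zero_of_summable_integral (fun n ω => sq_nonneg (Y n ω)) hY hb hs]
    with ω h3
  have h4 := (Real.continuous_sqrt.tendsto 0).comp h3
  rw [Real.sqrt_zero] at h4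
  rw [tendsto_zero_iff_abs_tendsto_zero]
  exact h4.congr (fun n => Real.sqrt_sq_eq_abs _)

end Model

/-! ### From moments to the indicator of N < k -/

section Moments

theorem integrable_continuous_comp_of_mem_Icc {Z : Type*} [MeasurableSpace Z] (κ : Measure Z)
    [IsFiniteMeasure κ] {G : Z → ℝ} (hGm : Measurable G) (hG : ∀ z, G z ∈ Set.Icc (0 : ℝ) 1)
    {φ : ℝ → ℝ} (hφ : Continuous φ) : Integrable (fun z => φ (G z)) κ := by
  obtain ⟨c, hc⟩ := isCompact_Icc.exists_bound_of_continuousOn (hφ.continuousOn (s := Set.Icc 0 1))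
  exact Integrable.of_bound (hφ.measurable.comp hGm).aestronglyMeasurable c
    (Eventually.of_forall fun z => hc _ (hG z))

theorem abs_integral_sub_le_of_near {Z : Type*} [MeasurableSpace Z] (κ : Measure Z)
    [IsFiniteMeasure κ] {G : Z → ℝ} (hGm : Measurable G) (hG : ∀ z, G z ∈ Set.Icc (0 : ℝ) 1)
    {φ ψ : ℝ → ℝ} (hφ : Continuous φ) (hψ : Continuous ψ) {ε : ℝ}
    (h : ∀ t ∈ Set.Icc (0 : ℝ) 1, |φ t - ψ t| ≤ ε) :
    |∫ z, φ (G z) ∂κ - ∫ z, ψ (G z) ∂κ| ≤ ε * κ.real Set.univ := by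
  rw [← integral_sub (integrable_continuous_comp_of_mem_Icc κ hGm hG hφ)
    (integrable_continuous_comp_of_mem_Icc κ hGm hG hψ), ← Real.norm_eq_abs]
  exact norm_integral_le_of_norm_le_const (Eventually.of_forall fun z => h _ (hG z))

theorem integral_polynomial_comp {Z : Type*} [MeasurableSpace Z] (κ : Measure Z)
    [IsFiniteMeasure κ] {G : Z → ℝ} (hGm : Measurable G) (hG : ∀ z, G z ∈ Set.Icc (0 : ℝ) 1)
    (P : Polynomial ℝ) :
    ∫ z, P.eval (G z) ∂κ = ∑ j ∈ Finset.range (P.natDegree + 1), P.coeff j * ∫ z, G z ^ j ∂κ := by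
  simp only [Polynomial.eval_eq_sum_range]
  rw [integral_finsetSum]
  · simp only [integral_const_mul]
  · intro j _
    exact (integrable_continuous_comp_of_mem_Icc κ hGm hG (continuous_pow j)).const_mul _

/-- Convergence of all moments of `[0, 1]`-valued functions implies convergence of the integrals
of continuous functions. -/
theorem tendsto_integral_of_tendsto_moments {E S : Type*} [MeasurableSpace E] [MeasurableSpace S]
    {ν : Measure E} [IsFiniteMeasure ν] {π : Measure S} [IsProbabilityMeasure π] {T : ℕ → E → ℝ}
    {H : S → ℝ} (hTm : ∀ n, Measurable (T n)) (hT : ∀ n x, T n x ∈ Set.Icc (0 : ℝ) 1)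
    (hHm : Measurable H) (hH : ∀ s, H s ∈ Set.Icc (0 : ℝ) 1)
    (h : ∀ j : ℕ, Tendsto (fun n => ∫ x, T n x ^ j ∂ν) atTop
      (𝓝 (ν.real Set.univ * ∫ s, H s ^ j ∂π)))
    {ψ : ℝ → ℝ} (hψ : Continuous ψ) :
    Tendsto (fun n => ∫ x, ψ (T n x) ∂ν) atTop (𝓝 (ν.real Set.univ * ∫ s, ψ (H s) ∂π)) := by
  rw [Metric.tendsto_atTop]
  intro ε hε
  set V := ν.real Set.univ with hV
  have hV0 : 0 ≤ V := measureReal_nonneg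
  -- Multiplied by the total mass V, this tolerance is at most ε/4; the +1 covers V = 0.
  obtain ⟨P, hP⟩ := exists_polynomial_near_of_continuousOn 0 1 ψ hψ.continuousOn
    (ε / (4 * (V + 1))) (by positivity)
  have hP' : ∀ t ∈ Set.Icc (0 : ℝ) 1, |P.eval t - ψ t| ≤ ε / (4 * (V + 1)) :=
    fun t ht => (hP t ht).le
  have hlim : Tendsto (fun n => ∫ x, P.eval (T n x) ∂ν) atTop (𝓝 (V * ∫ s, P.eval (H s) ∂π)) := by
    simp only [integral_polynomial_comp ν (hTm _) (hT _), integral_polynomial_comp π hHm hH,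
      Finset.mul_sum]
    refine tendsto_finsetSum _ (fun j _ => ?_)
    convert! (h j).const_mul (P.coeff j) using 2
    ring
  obtain ⟨N, hN⟩ := Metric.tendsto_atTop.mp hlim (ε / 4) (by positivity)
  refine ⟨N, fun n hn => ?_⟩
  have h1 := abs_integral_sub_le_of_near ν (hTm n) (hT n) P.continuous hψ hP'
  have h2 := abs_integral_sub_le_of_near π hHm hH P.continuous hψ hP'
  have h3 := hN n hn
  rw [probReal_univ, mul_one] at h2
  rw [Real.dist_eq] at h3 ⊢
  have hq : ε / (4 * (V + 1)) * V ≤ ε / 4 := by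
    rw [div_mul_eq_mul_div, div_le_div_iff₀ (by positivity) (by positivity)]
    nlinarith
  have h4 : |V * ∫ s, P.eval (H s) ∂π - V * ∫ s, ψ (H s) ∂π| ≤ ε / 4 := by
    rw [← mul_sub, abs_mul, abs_of_nonneg hV0]
    calc _ ≤ V * (ε / (4 * (V + 1))) := mul_le_mul_of_nonneg_left h2 hV0
      _ ≤ ε / 4 := by rw [mul_comm]; exact hq
  have h1' := h1.trans hq
  rw [abs_le] at h1' h4
  rw [abs_lt] at h3 ⊢
  constructor <;> linarith [h1'.1, h1'.2, h4.1, h4.2, h3.1, h3.2]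

/-- A continuous function of `2 ^ (-N)` that is the indicator function of `N < k`. -/
noncomputable def tent (k : ℕ) (t : ℝ) : ℝ := max 0 (min 1 (2 ^ k * t - 1))

theorem continuous_tent (k : ℕ) : Continuous (tent k) := by unfold tent; fun_prop

open Classical in
-- The weight takes no value strictly between 2^(-k) and 2^(-(k-1)): 2^k t - 1 is at least 1 for t =
-- 2^(-n) with n < k, and at most 0 for n ≥ k or t = 0.
theorem tent_halfPow (k : ℕ) (N : ℕ∞) : tent k (halfPow N) = if N < k then 1 else 0 := by
  induction N using ENat.recTopCoe with
  | top => simp [tent, halfPow]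
  | coe n =>
    have hn : halfPow (n : ℕ∞) = (1 / 2) ^ n := by simp [halfPow]
    rw [hn, tent]
    split_ifs with h
    · have h' : n < k := by exact_mod_cast h
      have : (2 : ℝ) ≤ 2 ^ k * (1 / 2) ^ n := by
        obtain ⟨l, rfl⟩ := Nat.exists_eq_add_of_lt h'
        rw [pow_succ, pow_add, one_div, inv_pow]
        have h1 : (1 : ℝ) ≤ 2 ^ l := one_le_pow₀ (by norm_num)
        have h2 : (2 : ℝ) ^ n * (2 ^ n)⁻¹ = 1 := mul_inv_cancel₀ (by positivity)
        nlinarith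
      rw [min_eq_left (by linarith), max_eq_right zero_le_one]
    · have h' : k ≤ n := by
        have := not_lt.mp h
        exact_mod_cast this
      have : (2 : ℝ) ^ k * (1 / 2) ^ n ≤ 1 := by
        rw [one_div, inv_pow, mul_inv_le_iff₀ (by positivity), one_mul]
        exact pow_le_pow_right₀ (by norm_num) h'
      rw [max_eq_left]
      exact (min_le_right _ _).trans (by linarith)

theorem integral_halfPow_pow (r : NNReal) (j : ℕ) :
    ∫ N, halfPow N ^ j ∂((poissonMeasure r).map (Nat.cast : ℕ → ℕ∞))
      = Real.exp (((1 / 2) ^ j - 1) * r) := by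
  rw [← (integral_pow_poisson r ((1 / 2) ^ j)).2, integral_map .of_discrete .of_discrete,
    integral_map .of_discrete .of_discrete]
  refine integral_congr_ae (Eventually.of_forall fun n => ?_)
  simp [halfPow, ← pow_mul, mul_comm]

theorem integral_tent_halfPow (r : NNReal) (k : ℕ) :
    ∫ N, tent k (halfPow N) ∂((poissonMeasure r).map (Nat.cast : ℕ → ℕ∞))
      = Real.exp (-r) * ∑ j ∈ Finset.range k, (r : ℝ) ^ j / j.factorial := by
  classical
  simp only [tent_halfPow]
  rw [integral_map_cast_poissonMeasure, tsum_eq_sum (s := Finset.range k), Finset.mul_sum]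
  · refine Finset.sum_congr rfl (fun j hj => ?_)
    have : (j : ℕ∞) < k := by exact_mod_cast Finset.mem_range.mp hj
    simp [this]
    ring
  · intro j hj
    have : ¬ (j : ℕ∞) < k := by
      have := not_lt.mp (fun h => hj (Finset.mem_range.mpr h))
      exact not_lt.mpr (by exact_mod_cast this)
    simp [this]

end Moments

/-- The set of points covered by fewer than `k` of the sets `X i + S i`, `i ∈ I`. -/
def sparseSet {E : Type*} [Add E] (k : ℕ) (I : Set ℕ) (X : ℕ → E) (S : ℕ → Set E) : Set E :=
  {x | (coverIdx I X S x).encard < k}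

/-! ### Almost sure statements along summable sequences of inverse intensities -/

section Model

variable {Ω : Type*} [MeasurableSpace Ω] {d : ℕ} {μ : Measure Ω} [IsProbabilityMeasure μ]
  {Q : Measure (Closeds (EuclideanSpace ℝ (Fin d)))}

local notation "𝔼" => EuclideanSpace ℝ (Fin d)

/-- With δ^d L = ρ exactly, the means do not depend on n and the variances are O(1/L), hence
summable. Countably many moments converge together almost surely, to those of 2^(-N) with N Poisson
of mean ρβ, and `tent k` reads off the volume. -/
theorem ae_tendsto_sparseSet {L : ℕ → ℝ} (hL : ∀ n, 0 < L n) (hLs : Summable fun n => (L n)⁻¹)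
    {X : ℕ → ℕ → Ω → 𝔼} {I : ℕ → Ω → Set ℕ} {C : ℕ → Ω → Closeds 𝔼}
    (hm : ∀ n, IsModel μ (L n) Q (X n) (I n) C) {τ : ℝ} (hτ : 0 ≤ τ)
    (hQ : ∀ᵐ F : Closeds 𝔼 ∂Q, (F : Set 𝔼) ⊆ Metric.closedBall 0 τ)
    {δ : ℕ → ℝ} (hδ : ∀ n, 0 < δ n) {ρ : ℝ} (hδL : ∀ n, δ n ^ d * L n = ρ) {β : ℝ}
    (hβ : β = ∫ F, volume.real (F : Set 𝔼) ∂Q) {A : Set 𝔼} (hAf : volume A ≠ ∞) (k : ℕ) :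
    ∀ᵐ ω ∂μ, Tendsto (fun n => volume.real (A ∩ sparseSet k (I n ω) (fun i => X n i ω)
      (fun i => δ n • (C i ω : Set 𝔼)))) atTop
      (𝓝 (volume.real A * (Real.exp (-(ρ * β)) *
        ∑ j ∈ Finset.range k, (ρ * β) ^ j / (j.factorial : ℝ)))) := by
  have : IsFiniteMeasure (volume.restrict A) := isFiniteMeasure_restrict.mpr hAf
  have hρ : 0 ≤ ρ := hδL 0 ▸ mul_nonneg (pow_nonneg (hδ 0).le d) (hL 0).le
  have hβ0 : 0 ≤ β := hβ ▸ integral_nonneg (fun F => measureReal_nonneg)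
  have hmom : ∀ j : ℕ, ∀ᵐ ω ∂μ, Tendsto (fun n => (∫ x in A, coverWeight (X n) (I n) C (δ n) ω x ^ j)
      - volume.real A * Real.exp (((1 / 2) ^ j - 1) * (ρ * β))) atTop (𝓝 0) := by
    intro j
    have h := fun n => integral_sq_sub_le (hm n) hτ (hL n).le (hδ n) hQ j hAf
    simp only [hδL, ← hβ] at h
    refine ae_tendsto_zero_of_summable_integral_sq (fun n => (h n).1) (fun n => (h n).2) ?_
    have : ∀ n, δ n ^ d = ρ * (L n)⁻¹ := fun n => by
      rw [← hδL n, mul_inv_cancel_right₀ (hL n).ne']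
    simp only [this]
    exact ((hLs.mul_left ρ).mul_right _).mul_left _
  filter_upwards [ae_all_iff.mpr hmom] with ω hω
  set r : NNReal := ⟨ρ * β, mul_nonneg hρ hβ0⟩ with hr
  have hr' : (r : ℝ) = ρ * β := rfl
  have hTm : ∀ n, Measurable (fun x => coverWeight (X n) (I n) C (δ n) ω x) := fun n =>
    (measurable_coverWeight (hm n) (hδ n)).comp measurable_prodMk_left
  have key := tendsto_integral_of_tendsto_moments (ν := volume.restrict A)
    (π := (poissonMeasure r).map (Nat.cast : ℕ → ℕ∞))
    (T := fun n x => coverWeight (X n) (I n) C (δ n) ω x) (H := halfPow) hTm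
    (fun n x => ⟨coverWeight_nonneg _ _ _, coverWeight_le_one _ _ _⟩) .of_discrete
    (fun N => ⟨halfPow_nonneg N, halfPow_le_one N⟩)
    (fun j => by
      rw [integral_halfPow_pow, measureReal_restrict_apply_univ, hr']
      simpa using (hω j).add_const (volume.real A * Real.exp (((1 / 2) ^ j - 1) * (ρ * β))))
    (continuous_tent k)
  rw [integral_tent_halfPow, measureReal_restrict_apply_univ] at key
  refine key.congr (fun n => ?_)
  have hset : sparseSet k (I n ω) (fun i => X n i ω) (fun i => δ n • (C i ω : Set 𝔼))
      = (fun x => tent k (coverWeight (X n) (I n) C (δ n) ω x)) ⁻¹' {1} := by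
    classical
    ext x
    simp [sparseSet, coverWeight, tent_halfPow]
  have hsm : MeasurableSet (sparseSet k (I n ω) (fun i => X n i ω)
      (fun i => δ n • (C i ω : Set 𝔼))) := by
    rw [hset]
    exact ((continuous_tent k).measurable.comp (hTm n)) (measurableSet_singleton 1)
  have hfun : ∀ x, tent k (coverWeight (X n) (I n) C (δ n) ω x)
      = (sparseSet k (I n ω) (fun i => X n i ω) (fun i => δ n • (C i ω : Set 𝔼))).indicator
        (fun _ => 1) x := by
    classical
    intro x
    rw [coverWeight, tent_halfPow]
    simp only [sparseSet, Set.indicator, Set.mem_ofPred_eq]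
    congr
  simp only [hfun]
  rw [integral_indicator_const _ hsm, smul_eq_mul, mul_one, measureReal_restrict_apply hsm,
    Set.inter_comm]

/-- An upper law of large numbers for the sums of a bounded function of the shapes over the points
in a fixed region. -/
theorem ae_eventually_finsum_le {L : ℕ → ℝ} (hL : ∀ n, 0 < L n)
    (hLs : Summable fun n => (L n)⁻¹) {X : ℕ → ℕ → Ω → 𝔼} {I : ℕ → Ω → Set ℕ}
    {C : ℕ → Ω → Closeds 𝔼} (hm : ∀ n, IsModel μ (L n) Q (X n) (I n) C)
    {B : Set 𝔼} (hBm : MeasurableSet B) (hBf : volume B ≠ ∞) {f : Closeds 𝔼 → ℝ}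
    (hf : Measurable f) (hf0 : ∀ F, 0 ≤ f F) {K : ℝ} (hfK : ∀ F, f F ≤ K) {ε : ℝ} (hε : 0 < ε) :
    ∀ᵐ ω ∂μ, ∀ᶠ n in atTop, (presentIn (X n) (I n) B ω).Finite ∧
      ∑ᶠ i ∈ presentIn (X n) (I n) B ω, f (C i ω)
        ≤ L n * (volume.real B * (Real.exp K * ∫ F, f F ∂Q) + ε) := by
  have hQP := isProbabilityMeasure_shapeLaw (hm 0)
  have hK0 : 0 ≤ K := (hf0 ⊥).trans (hfK ⊥)
  have hνB : ∀ n, (ENNReal.ofReal (L n) • (volume : Measure 𝔼)) B ≠ ∞ := fun n =>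
    smul_volume_ne_top hBf
  have hfi : Integrable f Q := Integrable.of_bound hf.aestronglyMeasurable K
    (Eventually.of_forall fun F => by rw [Real.norm_of_nonneg (hf0 F)]; exact hfK F)
  have hei : Integrable (fun F => Real.exp (f F)) Q :=
    Integrable.of_bound (Real.measurable_exp.comp hf).aestronglyMeasurable (Real.exp K)
      (Eventually.of_forall fun F => by
        rw [Real.norm_of_nonneg (Real.exp_pos _).le]; exact Real.exp_le_exp.mpr (hfK F))
  set a := volume.real B * (Real.exp K * ∫ F, f F ∂Q) + ε with ha
  set P : ℕ → Ω → ℝ := fun n ω => ∏ᶠ i ∈ presentIn (X n) (I n) B ω, Real.exp (f (C i ω)) with hP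
  have hPint : ∀ n, Integrable (P n) μ := by
    intro n
    refine ((hm n).poisson.integral_pow hBm (hνB n) (Real.exp K)).1.mono' ?_ ?_
    · exact ((hm n).poisson.aemeasurable_finprod hBm (hνB n)
        (fun i => Real.measurable_exp.comp
          (hf.comp ((hm n).measurable_shape i)))).aestronglyMeasurable
    · filter_upwards [(hm n).poisson.ae_finite hBm (hνB n)] with ω hω
      rw [Real.norm_of_nonneg (finprod_mem_nonneg' (fun i => (Real.exp_pos _).le))]
      exact finprod_mem_le_pow hω (Real.one_le_exp hK0) (fun i => (Real.exp_pos _).le)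
        (fun i => Real.exp_le_exp.mpr (hfK _))
  have hPle : ∀ n, ∫ ω, P n ω ∂μ ≤ Real.exp (L n * (a - ε)) := by
    intro n
    have hg : Measurable (Function.uncurry fun (F : Closeds 𝔼) (_ : 𝔼) => Real.exp (f F)) :=
      Real.measurable_exp.comp (hf.comp measurable_fst)
    have key := (hm n).poisson.integral_finprod_marked (g := fun F _ => Real.exp (f F))
      (hm n).measurable_shape (hm n).hasLaw_shape
      (hm n).iIndepFun_shape (hm n).indepFun_shape_points hBm (hνB n) hg
      (Real.one_le_exp hK0) (fun F p => (Real.exp_pos _).le)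
      (fun F p => Real.exp_le_exp.mpr (hfK F))
    rw [setIntegral_const, measureReal_def, Measure.smul_apply, smul_eq_mul, smul_eq_mul,
      ENNReal.toReal_mul, ENNReal.toReal_ofReal (hL n).le, ← measureReal_def] at key
    rw [key, Real.exp_le_exp, mul_assoc]
    refine mul_le_mul_of_nonneg_left ?_ (hL n).le
    rw [ha, add_sub_cancel_right]
    refine mul_le_mul_of_nonneg_left ?_ measureReal_nonneg
    -- The exponent is linearized by e^f - 1 ≤ e^K f for 0 ≤ f ≤ K, which is where the factor e^K in
    -- the bound comes from.
    have h1 : ∫ F, Real.exp (f F) ∂Q - 1 = ∫ F, (Real.exp (f F) - 1) ∂Q := by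
      rw [integral_sub hei (integrable_const _)]; simp
    rw [h1, ← integral_const_mul]
    refine integral_mono (hei.sub (integrable_const _)) (hfi.const_mul _) (fun F => ?_)
    have h2 : 1 - f F ≤ Real.exp (-f F) := by linarith [Real.add_one_le_exp (-f F)]
    have h3 : Real.exp (f F) * Real.exp (-f F) = 1 := by rw [← Real.exp_add]; simp
    have h4 : Real.exp (f F) ≤ Real.exp K := Real.exp_le_exp.mpr (hfK F)
    change Real.exp (f F) - 1 ≤ Real.exp K * f F
    nlinarith [Real.exp_pos (f F), hf0 F]
  -- Exponential Markov inequality: the normalized product has mean at most exp(-εL) ≤ 1/(εL), which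
  -- is summable. Once it is below 1, taking logarithms gives the bound on the sum.
  have hlim := ae_tendsto_zero_of_summable_integral (μ := μ)
    (Y := fun n ω => P n ω * Real.exp (-(L n * a))) (b := fun n => ε⁻¹ * (L n)⁻¹)
    (fun n ω => mul_nonneg (finprod_mem_nonneg' (fun i => (Real.exp_pos _).le))
      (Real.exp_pos _).le)
    (fun n => (hPint n).mul_const _)
    (fun n => by
      rw [integral_mul_const]
      calc _ ≤ Real.exp (L n * (a - ε)) * Real.exp (-(L n * a)) :=
            mul_le_mul_of_nonneg_right (hPle n) (Real.exp_pos _).le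
        _ = (Real.exp (ε * L n))⁻¹ := by rw [← Real.exp_add, ← Real.exp_neg]; ring_nf
        _ ≤ (ε * L n)⁻¹ := by
            refine inv_anti₀ (mul_pos hε (hL n)) ?_
            linarith [Real.add_one_le_exp (ε * L n)]
        _ = ε⁻¹ * (L n)⁻¹ := mul_inv _ _)
    (hLs.mul_left _)
  filter_upwards [hlim, ae_all_iff.mpr fun n => (hm n).poisson.ae_finite hBm (hνB n)] with ω h1 h2
  filter_upwards [h1.eventually_lt_const zero_lt_one] with n hn
  refine ⟨h2 n, ?_⟩
  rw [hP] at hn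
  simp only [finprod_mem_eq_finite_toFinset_prod _ (h2 n)] at hn
  rw [← Real.exp_sum, ← Real.exp_add, ← Real.exp_zero, Real.exp_lt_exp] at hn
  rw [finsum_mem_eq_finite_toFinset_sum _ (h2 n)]
  linarith

end Model

/-! ### Thin shells around closed sets -/

section Shapes

variable {d : ℕ}

local notation "𝔼" => EuclideanSpace ℝ (Fin d)

/-- The volume of the part of the `η τ`-neighbourhood of `F` outside `F`, restricted to a ball. -/
noncomputable def shapeDefect (η τ : ℝ) (F : Closeds 𝔼) : ℝ :=
  volume.real ((Metric.cthickening (η * τ) (F : Set 𝔼) \ F) ∩ Metric.closedBall 0 (2 * τ))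

theorem measurable_shapeDefect (η τ : ℝ) : Measurable (shapeDefect (d := d) η τ) := by
  have hs : MeasurableSet {z : Closeds 𝔼 × 𝔼 | z.2 ∈
      (Metric.cthickening (η * τ) (z.1 : Set 𝔼) \ z.1) ∩ Metric.closedBall 0 (2 * τ)} :=
    ((measurableSet_mem_cthickening _).diff measurableSet_mem_closeds).inter
      (measurable_snd measurableSet_closedBall)
  exact (measurable_measure_prodMk_left (ν := (volume : Measure 𝔼)) hs).ennreal_toReal

theorem shapeDefect_nonneg (η τ : ℝ) (F : Closeds 𝔼) : 0 ≤ shapeDefect η τ F := measureReal_nonneg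

/-- The cut-off by a ball gives a bound for every closed F, not just almost every one, as
`ae_eventually_finsum_le` requires. -/
theorem shapeDefect_le (η τ : ℝ) (F : Closeds 𝔼) :
    shapeDefect η τ F ≤ volume.real (Metric.closedBall (0 : 𝔼) (2 * τ)) :=
  measureReal_mono Set.inter_subset_right measure_closedBall_lt_top.ne

/-- A closed set is the intersection of its closed thickenings, and boundedness keeps their volumes
finite. -/
theorem tendsto_shapeDefect {τ : ℝ} (F : Closeds 𝔼)
    (hF : (F : Set 𝔼) ⊆ Metric.closedBall 0 τ) :
    Tendsto (fun n : ℕ => shapeDefect (1 / (n + 1 : ℝ)) τ F) atTop (𝓝 0) := by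
  have hb : Bornology.IsBounded (F : Set 𝔼) := Metric.isBounded_closedBall.subset hF
  have hF1 : volume (F : Set 𝔼) ≠ ∞ := hb.measure_lt_top.ne
  have h1 := tendsto_measure_cthickening_of_isClosed (μ := (volume : Measure 𝔼)) (s := (F : Set 𝔼))
    ⟨1, one_pos, hb.cthickening.measure_lt_top.ne⟩ F.isClosed
  have h2 : Tendsto (fun n : ℕ => 1 / (n + 1 : ℝ) * τ) atTop (𝓝 0) := by
    simpa using (tendsto_one_div_add_atTop_nhds_zero_nat (𝕜 := ℝ)).mul_const τ
  have h3 := (ENNReal.tendsto_toReal hF1).comp (h1.comp h2)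
  have h4 := h3.sub_const (volume (F : Set 𝔼)).toReal
  rw [sub_self] at h4
  refine squeeze_zero (fun n => shapeDefect_nonneg _ _ _) (fun n => ?_) h4
  have hfin : volume (Metric.cthickening (1 / (n + 1 : ℝ) * τ) (F : Set 𝔼)) ≠ ∞ :=
    hb.cthickening.measure_lt_top.ne
  calc shapeDefect (1 / (n + 1 : ℝ)) τ F
      ≤ volume.real (Metric.cthickening (1 / (n + 1 : ℝ) * τ) (F : Set 𝔼) \ F) :=
        measureReal_mono Set.inter_subset_left (measure_ne_top_of_subset Set.sdiff_subset hfin)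
    _ = _ := measureReal_sdiff (Metric.self_subset_cthickening _) F.isClosed.measurableSet hfin

/-- One η serves both the random shapes, on average, and the window A, which is itself dilated under
the rescaled coupling. -/
theorem exists_shapeDefect_small {Q : Measure (Closeds 𝔼)} [IsProbabilityMeasure Q] {τ : ℝ}
    (hQ : ∀ᵐ F : Closeds 𝔼 ∂Q, (F : Set 𝔼) ⊆ Metric.closedBall 0 τ) {r : ℝ} (A : Closeds 𝔼)
    (hA : (A : Set 𝔼) ⊆ Metric.closedBall 0 r) {ε : ℝ} (hε : 0 < ε) :
    ∃ η : ℝ, 0 < η ∧ η ≤ 1 ∧ ∫ F, shapeDefect η τ F ∂Q < ε ∧ shapeDefect η r A < ε := by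
  have h1 : Tendsto (fun n : ℕ => ∫ F, shapeDefect (1 / (n + 1 : ℝ)) τ F ∂Q) atTop
      (𝓝 (∫ F : Closeds 𝔼, 0 ∂Q)) := by
    refine tendsto_integral_of_dominated_convergence
      (fun _ => volume.real (Metric.closedBall (0 : 𝔼) (2 * τ)))
      (fun n => (measurable_shapeDefect _ _).aestronglyMeasurable) (integrable_const _)
      (fun n => Eventually.of_forall fun F => ?_) ?_
    · rw [Real.norm_of_nonneg (shapeDefect_nonneg _ _ _)]
      exact shapeDefect_le _ _ _
    · filter_upwards [hQ] with F hF
      exact tendsto_shapeDefect F hF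
  rw [integral_zero] at h1
  obtain ⟨n, hn1, hn2⟩ :=
    ((h1.eventually_lt_const hε).and ((tendsto_shapeDefect A hA).eventually_lt_const hε)).exists
  refine ⟨1 / (n + 1 : ℝ), by positivity, ?_, hn1, hn2⟩
  rw [div_le_one (by positivity)]
  linarith [(Nat.cast_nonneg n : (0 : ℝ) ≤ n)]

/-- After division by b, a point (a/b)y with y in F lies within |a/b - 1| ‖y‖ ≤ ητ of F and has norm
at most 2τ, so if outside F it lies in the shell. -/
theorem measureReal_smul_diff_smul_le {η τ a b : ℝ} (hη : η ≤ 1) (hb : 0 < b)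
    (hab : a ≤ (1 + η) * b) (hba : b ≤ (1 + η) * a) (hη0 : 0 < η) (F : Closeds 𝔼)
    (hF : (F : Set 𝔼) ⊆ Metric.closedBall 0 τ) :
    volume.real (a • (F : Set 𝔼) \ b • (F : Set 𝔼)) ≤ b ^ d * shapeDefect η τ F := by
  have hr1 : a / b ≤ 1 + η := by rwa [div_le_iff₀ hb]
  have hr2 : 1 - η ≤ a / b := by
    rw [le_div_iff₀ hb]
    nlinarith
  have hr : |a / b - 1| ≤ η := by rw [abs_le]; constructor <;> linarith
  have hsub : a • (F : Set 𝔼) \ b • (F : Set 𝔼) ⊆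
      b • ((Metric.cthickening (η * τ) (F : Set 𝔼) \ F) ∩ Metric.closedBall 0 (2 * τ)) := by
    rintro x ⟨⟨y, hy, rfl⟩, hx⟩
    rw [Set.mem_smul_set_iff_inv_smul_mem₀ hb.ne'] at hx ⊢
    have e : b⁻¹ • a • y = (a / b) • y := by rw [smul_smul, inv_mul_eq_div]
    have hyn : ‖y‖ ≤ τ := mem_closedBall_zero_iff.mp (hF hy)
    dsimp only at hx ⊢
    rw [e] at hx ⊢
    refine ⟨⟨?_, hx⟩, ?_⟩
    · refine Metric.mem_cthickening_of_dist_le _ y _ _ hy ?_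
      rw [dist_eq_norm, show (a / b) • y - y = (a / b - 1) • y by rw [sub_smul, one_smul],
        norm_smul, Real.norm_eq_abs]
      exact mul_le_mul hr hyn (norm_nonneg _) hη0.le
    · rw [mem_closedBall_zero_iff, norm_smul, Real.norm_eq_abs]
      have : |a / b| ≤ 2 := by rw [abs_le]; constructor <;> linarith
      exact mul_le_mul this hyn (norm_nonneg _) zero_le_two
  have hfin : volume ((Metric.cthickening (η * τ) (F : Set 𝔼) \ F) ∩
      Metric.closedBall 0 (2 * τ)) ≠ ∞ :=
    measure_ne_top_of_subset Set.inter_subset_right measure_closedBall_lt_top.ne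
  have e1 : volume.real (b • ((Metric.cthickening (η * τ) (F : Set 𝔼) \ F) ∩
      Metric.closedBall 0 (2 * τ))) = b ^ d * shapeDefect η τ F := by
    rw [measureReal_def, Measure.addHaar_smul, finrank_euclideanSpace, Fintype.card_fin,
      ENNReal.toReal_mul, ENNReal.toReal_ofReal (abs_nonneg _), abs_of_pos (pow_pos hb d)]
    rfl
  rw [← e1]
  refine measureReal_mono hsub ?_
  rw [Measure.addHaar_smul]
  exact ENNReal.mul_ne_top ENNReal.ofReal_ne_top hfin

end Shapes

/-! ### Changing shapes, scale and intensity in the sparse set -/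

section Sparse

variable {d : ℕ}

local notation "𝔼" => EuclideanSpace ℝ (Fin d)

theorem sparseSet_anti {E : Type*} [Add E] {k : ℕ} {I I' : Set ℕ} {X X' : ℕ → E}
    {S : ℕ → Set E} (hI : ∀ i ∈ I, i ∈ I' ∧ X' i = X i) :
    sparseSet k I' X' S ⊆ sparseSet k I X S := by
  intro x hx
  refine lt_of_le_of_lt (Set.encard_le_encard ?_) hx
  rintro i ⟨hi, hxi⟩
  exact ⟨(hI i hi).1, by rwa [(hI i hi).2]⟩

/-- If x is sparse for S' but not for S, some index covers x through S and not through S', which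
puts x in X i + (S i \ S' i). -/
theorem sparseSet_inter_subset {k : ℕ} {I : Set ℕ} {X : ℕ → 𝔼} {S S' : ℕ → Set 𝔼} {A B : Set 𝔼}
    (hB : ∀ i ∈ I, ((X i +ᵥ S i) ∩ A).Nonempty → X i ∈ B) :
    A ∩ sparseSet k I X S' ⊆ (A ∩ sparseSet k I X S) ∪
      ⋃ i ∈ {i | i ∈ I ∧ X i ∈ B}, X i +ᵥ (S i \ S' i) := by
  rintro x ⟨hxA, hx⟩
  by_cases hsub : coverIdx I X S x ⊆ coverIdx I X S' x
  · exact Or.inl ⟨hxA, lt_of_le_of_lt (Set.encard_le_encard hsub) hx⟩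
  · obtain ⟨i, ⟨hi1, hi2⟩, hi3⟩ := Set.not_subset.mp hsub
    refine Or.inr (Set.mem_biUnion (x := i) ⟨hi1, hB i hi1 ⟨x, hi2, hxA⟩⟩ ?_)
    rw [Set.mem_vadd_set_iff_neg_vadd_mem] at hi2 ⊢
    refine ⟨hi2, fun h => hi3 ⟨hi1, ?_⟩⟩
    rwa [Set.mem_vadd_set_iff_neg_vadd_mem]

theorem measureReal_inter_sparseSet_le {k : ℕ} {I : Set ℕ} {X : ℕ → 𝔼} {S S' : ℕ → Set 𝔼}
    {A B : Set 𝔼} (hA : volume A ≠ ∞) (hB : ∀ i ∈ I, ((X i +ᵥ S i) ∩ A).Nonempty → X i ∈ B)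
    (hfin : {i | i ∈ I ∧ X i ∈ B}.Finite) (hS : ∀ i, volume (S i) ≠ ∞) :
    volume.real (A ∩ sparseSet k I X S') ≤ volume.real (A ∩ sparseSet k I X S) +
      ∑ᶠ i ∈ {i | i ∈ I ∧ X i ∈ B}, volume.real (S i \ S' i) := by
  have hv : ∀ i, volume (X i +ᵥ (S i \ S' i)) = volume (S i \ S' i) := fun i => measure_vadd _ _ _
  have hS' : ∀ i, volume (X i +ᵥ (S i \ S' i)) ≠ ∞ := fun i => by
    rw [hv]; exact measure_ne_top_of_subset Set.sdiff_subset (hS i)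
  have hU : volume (⋃ i ∈ {i | i ∈ I ∧ X i ∈ B}, X i +ᵥ (S i \ S' i)) ≠ ∞ :=
    (measure_biUnion_lt_top hfin (fun i _ => (hS' i).lt_top)).ne
  refine (measureReal_mono (sparseSet_inter_subset hB) (measure_union_ne_top
    (measure_ne_top_of_subset Set.inter_subset_left hA) hU)).trans ?_
  refine (measureReal_union_le _ _).trans (add_le_add_right ?_ _)
  rw [finsum_mem_eq_finite_toFinset_sum _ hfin]
  have e : (⋃ i ∈ {i | i ∈ I ∧ X i ∈ B}, X i +ᵥ (S i \ S' i))
      = ⋃ i ∈ hfin.toFinset, X i +ᵥ (S i \ S' i) := by simp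
  rw [e]
  refine (measureReal_biUnion_finset_le _ _).trans_eq (Finset.sum_congr rfl fun i _ => ?_)
  rw [measureReal_def, hv, measureReal_def]

theorem sparseSet_smul {k : ℕ} {I : Set ℕ} {X X' : ℕ → 𝔼} {s δ : ℝ} (hs : 0 < s) (hδ : 0 < δ)
    (hX : ∀ i ∈ I, X' i = s • X i) (C : ℕ → Set 𝔼) :
    sparseSet k I X' (fun i => δ • C i) = s • sparseSet k I X (fun i => (s⁻¹ * δ) • C i) := by
  ext x
  rw [Set.mem_smul_set_iff_inv_smul_mem₀ hs.ne']
  have : coverIdx I X' (fun i => δ • C i) x = coverIdx I X (fun i => (s⁻¹ * δ) • C i) (s⁻¹ • x) := by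
    ext i
    simp only [coverIdx, Set.mem_ofPred_eq, mem_vadd_smul_iff hδ,
      mem_vadd_smul_iff (mul_pos (inv_pos.mpr hs) hδ)]
    refine and_congr_right fun hi => ?_
    rw [hX i hi]
    have : (s⁻¹ * δ)⁻¹ • (s⁻¹ • x - X i) = δ⁻¹ • (x - s • X i) := by
      rw [smul_sub, smul_sub, smul_smul, smul_smul]
      congr 2
      · field_simp
      · field_simp
    rw [this]
  simp only [sparseSet, Set.mem_ofPred_eq, this]

theorem measureReal_inter_smul {c : ℝ} (hc : 0 < c) (A S : Set 𝔼) :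
    volume.real (A ∩ c⁻¹ • S) = (c ^ d)⁻¹ * volume.real (c • A ∩ S) := by
  have : A ∩ c⁻¹ • S = c⁻¹ • (c • A ∩ S) := by
    rw [Set.smul_set_inter₀ (inv_ne_zero hc.ne'), smul_smul, inv_mul_cancel₀ hc.ne', one_smul]
  rw [this, measureReal_def, Measure.addHaar_smul, finrank_euclideanSpace, Fintype.card_fin,
    ENNReal.toReal_mul, ENNReal.toReal_ofReal (abs_nonneg _),
    abs_of_pos (pow_pos (inv_pos.mpr hc) d), inv_pow, measureReal_def]

theorem measureReal_inter_le_add_diff {A A' S : Set 𝔼} (hA : volume A ≠ ∞) (hA' : volume A' ≠ ∞) :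
    volume.real (A' ∩ S) ≤ volume.real (A ∩ S) + volume.real (A' \ A) := by
  refine (measureReal_mono (s₂ := (A ∩ S) ∪ (A' \ A)) ?_ ?_).trans (measureReal_union_le _ _)
  · rintro x ⟨h1, h2⟩
    by_cases h : x ∈ A
    · exact Or.inl ⟨h, h2⟩
    · exact Or.inr ⟨h1, h⟩
  · exact measure_union_ne_top (measure_ne_top_of_subset Set.inter_subset_left hA)
      (measure_ne_top_of_subset Set.sdiff_subset hA')

theorem volume_smul_ne_top {A : Set 𝔼} (hA : volume A ≠ ∞) (c : ℝ) : volume (c • A) ≠ ∞ := by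
  rw [Measure.addHaar_smul]
  exact ENNReal.mul_ne_top ENNReal.ofReal_ne_top hA

/-- The point sets of all intensities are nested, or rescalings of each other. -/
def Coupled (X : ℝ → ℕ → 𝔼) (I : ℝ → Set ℕ) : Prop :=
  (∀ a b : ℝ, 0 < a → a ≤ b → ∀ i ∈ I a, i ∈ I b ∧ X b i = X a i) ∨
  (∀ a : ℝ, 0 < a → I a = I 1 ∧ ∀ i ∈ I 1, X a i = (a ^ (-(1 / (d : ℝ)))) • X 1 i)

theorem rescaled_smul_eq (hd : 0 < d) {X : ℝ → ℕ → 𝔼} {I : ℝ → Set ℕ}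
    (h : ∀ a : ℝ, 0 < a → I a = I 1 ∧ ∀ i ∈ I 1, X a i = (a ^ (-(1 / (d : ℝ)))) • X 1 i)
    {a b c : ℝ} (ha : 0 < a) (hb : 0 < b) (hc : 0 < c) (hcd : c ^ d * a = b) :
    I b = I a ∧ ∀ i ∈ I a, X a i = c • X b i := by
  refine ⟨(h b hb).1.trans (h a ha).1.symm, fun i hi => ?_⟩
  rw [(h a ha).1] at hi
  rw [(h a ha).2 i hi, (h b hb).2 i hi, smul_smul]
  congr 1
  rw [← hcd, Real.mul_rpow (by positivity) ha.le, ← Real.rpow_natCast, ← Real.rpow_mul hc.le,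
    ← mul_assoc]
  have : (d : ℝ) * -(1 / d) = -1 := by field_simp
  rw [this, Real.rpow_neg_one, mul_inv_cancel₀ hc.ne', one_mul]

/-- Nested: more sets leave a smaller sparse set, with δ' = δ. Rescaled: the configuration at b is
that at a contracted by c, so the sparse set is 1/c times the one at a with scale cδ. Undoing the
contraction replaces A by cA and gains the factor c^(-d) ≤ 1. -/
theorem Coupled.measureReal_le (hd : 0 < d) {X : ℝ → ℕ → 𝔼} {I : ℝ → Set ℕ} (h : Coupled X I)
    {a b c δ : ℝ} (ha : 0 < a) (hc : 1 ≤ c) (hcd : c ^ d * a = b) (hδ : 0 < δ)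
    (k : ℕ) (C : ℕ → Set 𝔼) {A : Set 𝔼} (hA : volume A ≠ ∞) :
    ∃ δ', (δ' = δ ∨ δ' = c * δ) ∧
      volume.real (A ∩ sparseSet k (I b) (X b) (fun i => δ • C i)) ≤
      volume.real (A ∩ sparseSet k (I a) (X a) (fun i => δ' • C i)) + volume.real (c • A \ A) := by
  have hc0 : 0 < c := one_pos.trans_le hc
  have hcd1 : 1 ≤ c ^ d := one_le_pow₀ hc
  have hab : a ≤ b := by nlinarith
  rcases h with h | h
  · refine ⟨δ, Or.inl rfl, ?_⟩
    have := measureReal_mono (μ := volume) (Set.inter_subset_inter_right A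
      (sparseSet_anti (k := k) (S := fun i => δ • C i) (h a b ha hab)))
      (measure_ne_top_of_subset Set.inter_subset_left hA)
    linarith [measureReal_nonneg (μ := (volume : Measure 𝔼)) (s := c • A \ A)]
  · obtain ⟨hI, hX⟩ := rescaled_smul_eq hd h ha (ha.trans_le hab) hc0 hcd
    refine ⟨c * δ, Or.inr rfl, ?_⟩
    rw [hI, sparseSet_smul (inv_pos.mpr hc0) hδ (X := X a) (fun i hi => by
      rw [hX i hi, smul_smul, inv_mul_cancel₀ hc0.ne', one_smul]), inv_inv,
      measureReal_inter_smul hc0]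
    refine le_trans ?_ (measureReal_inter_le_add_diff hA (volume_smul_ne_top hA c))
    refine mul_le_of_le_one_left measureReal_nonneg (inv_le_one_of_one_le₀ hcd1)

/-- The companion bound: the configuration at a is that at b dilated by c, so the window shrinks to
A/c and the Jacobian c^d ≥ 1 is again on the favourable side. -/
theorem Coupled.le_measureReal (hd : 0 < d) {X : ℝ → ℕ → 𝔼} {I : ℝ → Set ℕ} (h : Coupled X I)
    {a b c δ : ℝ} (ha : 0 < a) (hc : 1 ≤ c) (hcd : c ^ d * a = b) (hδ : 0 < δ)
    (k : ℕ) (C : ℕ → Set 𝔼) {A : Set 𝔼} (hA : volume A ≠ ∞) :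
    ∃ δ', (δ' = δ ∨ δ' = c⁻¹ * δ) ∧
      volume.real (A ∩ sparseSet k (I b) (X b) (fun i => δ' • C i)) ≤
      volume.real (A ∩ sparseSet k (I a) (X a) (fun i => δ • C i)) +
        volume.real (A \ c⁻¹ • A) := by
  have hc0 : 0 < c := one_pos.trans_le hc
  have hcd1 : 1 ≤ c ^ d := one_le_pow₀ hc
  have hab : a ≤ b := by nlinarith
  rcases h with h | h
  · refine ⟨δ, Or.inl rfl, ?_⟩
    have := measureReal_mono (μ := volume) (Set.inter_subset_inter_right A
      (sparseSet_anti (k := k) (S := fun i => δ • C i) (h a b ha hab)))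
      (measure_ne_top_of_subset Set.inter_subset_left hA)
    linarith [measureReal_nonneg (μ := (volume : Measure 𝔼)) (s := A \ c⁻¹ • A)]
  · obtain ⟨hI, hX⟩ := rescaled_smul_eq hd h ha (ha.trans_le hab) hc0 hcd
    refine ⟨c⁻¹ * δ, Or.inr rfl, ?_⟩
    rw [hI, sparseSet_smul hc0 hδ hX]
    have e := measureReal_inter_smul (inv_pos.mpr hc0) A
      (sparseSet k (I a) (X b) (fun i => (c⁻¹ * δ) • C i))
    rw [inv_inv, inv_pow, inv_inv] at e
    rw [e]
    refine (measureReal_inter_le_add_diff (volume_smul_ne_top hA c⁻¹) hA).trans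
      (add_le_add_left ?_ _)
    exact le_mul_of_one_le_left measureReal_nonneg hcd1

/-- Raising the intensity adds points or contracts towards the origin; neither removes points from a
ball centred there. -/
theorem Coupled.mem_ball (hd : 0 < d) {X : ℝ → ℕ → 𝔼} {I : ℝ → Set ℕ} (h : Coupled X I)
    {a b c r : ℝ} (ha : 0 < a) (hc : 1 ≤ c) (hcd : c ^ d * a = b) {i : ℕ} (hi : i ∈ I a)
    (hX : X a i ∈ Metric.closedBall 0 r) : i ∈ I b ∧ X b i ∈ Metric.closedBall 0 r := by
  have hc0 : 0 < c := one_pos.trans_le hc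
  have hcd1 : 1 ≤ c ^ d := one_le_pow₀ hc
  have hab : a ≤ b := by nlinarith
  rcases h with h | h
  · obtain ⟨h1, h2⟩ := h a b ha hab i hi
    exact ⟨h1, by rwa [h2]⟩
  · obtain ⟨hI, hs⟩ := rescaled_smul_eq hd h ha (ha.trans_le hab) hc0 hcd
    rw [hs i hi, mem_closedBall_zero_iff, norm_smul, Real.norm_of_nonneg hc0.le] at hX
    refine ⟨hI ▸ hi, mem_closedBall_zero_iff.mpr (le_trans ?_ hX)⟩
    exact le_mul_of_one_le_left (norm_nonneg _) hc

end Sparse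

/-! ### Interpolation between geometric intensities for a fixed configuration -/

section Deterministic

variable {d : ℕ}

local notation "𝔼" => EuclideanSpace ℝ (Fin d)

theorem mem_closedBall_of_meets {F A : Set 𝔼} {p : 𝔼} {δ τ r : ℝ} (hF : F ⊆ Metric.closedBall 0 τ)
    (hA : A ⊆ Metric.closedBall 0 r) (hδ : 0 < δ) (hδ1 : δ ≤ 1)
    (h : ((p +ᵥ δ • F) ∩ A).Nonempty) : p ∈ Metric.closedBall 0 (r + τ) := by
  obtain ⟨x, hx, hxA⟩ := h
  rw [mem_vadd_smul_iff hδ] at hx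
  have h1 := dist_le_of_mem_ball hδ (hF hx)
  have h0 := mem_closedBall_zero_iff.mp (hF hx)
  have h2 := mem_closedBall_zero_iff.mp (hA hxA)
  rw [dist_eq_norm] at h1
  rw [mem_closedBall_zero_iff]
  have h3 : ‖p‖ ≤ ‖p - x‖ + ‖x‖ := by simpa using norm_add_le (p - x) x
  nlinarith [norm_nonneg (δ⁻¹ • (x - p))]

theorem measureReal_inter_sparseSet_scale_le {C : ℕ → Closeds 𝔼} {τ : ℝ}
    (hC : ∀ i, (C i : Set 𝔼) ⊆ Metric.closedBall 0 τ) {I : Set ℕ} {X : ℕ → 𝔼} {A : Set 𝔼} {r : ℝ}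
    (hA : A ⊆ Metric.closedBall 0 r)
    (hfin : {i | i ∈ I ∧ X i ∈ Metric.closedBall 0 (r + τ)}.Finite) {η δ δ' : ℝ} (hη0 : 0 < η)
    (hη : η ≤ 1) (hδ : 0 < δ) (hδ1 : δ ≤ 1) (hδ' : 0 < δ') (h1 : δ ≤ (1 + η) * δ')
    (h2 : δ' ≤ (1 + η) * δ) (k : ℕ) :
    volume.real (A ∩ sparseSet k I X (fun i => δ' • (C i : Set 𝔼))) ≤
      volume.real (A ∩ sparseSet k I X (fun i => δ • (C i : Set 𝔼))) +
      δ' ^ d * ∑ᶠ i ∈ {i | i ∈ I ∧ X i ∈ Metric.closedBall 0 (r + τ)}, shapeDefect η τ (C i) := by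
  have hAf : volume A ≠ ∞ := measure_ne_top_of_subset hA measure_closedBall_lt_top.ne
  refine (measureReal_inter_sparseSet_le (B := Metric.closedBall 0 (r + τ)) hAf
    (fun i _ h => mem_closedBall_of_meets (hC i) hA hδ hδ1 h) hfin
    (fun i => volume_smul_ne_top (measure_ne_top_of_subset (hC i) measure_closedBall_lt_top.ne) δ)
    ).trans (add_le_add_right ?_ _)
  rw [finsum_mem_eq_finite_toFinset_sum _ hfin, finsum_mem_eq_finite_toFinset_sum _ hfin,
    Finset.mul_sum]
  exact Finset.sum_le_sum fun i _ => measureReal_smul_diff_smul_le hη hδ' h1 h2 hη0 (C i) (hC i)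

/-- In q^2, one factor q allows for l lying anywhere between q^n and q^(n+1), the other for δ^d l
being only close to ρ. -/
theorem scale_near (hd : 0 < d) {η q ρ x y L : ℝ} (hη : 0 < η) (hρ : 0 < ρ)
    (hqη : q ^ 2 ≤ (1 + η) ^ d) (hx : 0 < x) (hy : 0 < y) (hL : 0 < L) (hyL : y ^ d * L = ρ)
    (h1 : ρ ≤ q ^ 2 * (x ^ d * L)) (h2 : x ^ d * L ≤ q ^ 2 * ρ) :
    x ≤ (1 + η) * y ∧ y ≤ (1 + η) * x := by
  have hpx : 0 < x ^ d := pow_pos hx d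
  have hpy : 0 < y ^ d := pow_pos hy d
  constructor
  · refine le_of_pow_le_pow_left₀ hd.ne' (by positivity) ?_
    rw [mul_pow]
    refine le_of_mul_le_mul_right ?_ hL
    calc x ^ d * L ≤ q ^ 2 * ρ := h2
      _ ≤ (1 + η) ^ d * ρ := mul_le_mul_of_nonneg_right hqη hρ.le
      _ = (1 + η) ^ d * y ^ d * L := by rw [← hyL]; ring
  · refine le_of_pow_le_pow_left₀ hd.ne' (by positivity) ?_
    rw [mul_pow]
    refine le_of_mul_le_mul_right ?_ hL
    calc y ^ d * L = ρ := hyL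
      _ ≤ q ^ 2 * (x ^ d * L) := h1
      _ ≤ (1 + η) ^ d * (x ^ d * L) := mul_le_mul_of_nonneg_right hqη (by positivity)
      _ = (1 + η) ^ d * x ^ d * L := by ring

theorem exists_pow_mul_eq (hd : 0 < d) {a b : ℝ} (ha : 0 < a) (hab : a ≤ b) :
    ∃ c : ℝ, 1 ≤ c ∧ c ^ d * a = b := by
  have h1 : 1 ≤ b / a := (one_le_div ha).mpr hab
  have h2 : ((b / a) ^ ((d : ℝ)⁻¹)) ^ d = b / a :=
    Real.rpow_inv_natCast_pow (zero_le_one.trans h1) hd.ne'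
  refine ⟨(b / a) ^ ((d : ℝ)⁻¹), Real.one_le_rpow h1 (by positivity), ?_⟩
  rw [h2, div_mul_cancel₀ _ ha.ne']

theorem eventually_exists_pow_near {q : ℝ} (hq : 1 < q) {p : ℕ → Prop} (hp : ∀ᶠ n in atTop, p n) :
    ∀ᶠ l : ℝ in atTop, ∃ n : ℕ, q ^ n ≤ l ∧ l < q ^ (n + 1) ∧ p n ∧ p (n + 1) := by
  obtain ⟨N, hN⟩ := eventually_atTop.mp hp
  filter_upwards [eventually_ge_atTop (q ^ N)] with l hl
  obtain ⟨n, h1, h2⟩ := exists_nat_pow_near ((one_le_pow₀ hq.le).trans hl) hq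
  have hn : N ≤ n := by
    have := (pow_lt_pow_iff_right₀ hq).mp (hl.trans_lt h2)
    omega
  exact ⟨n, h1, h2, hN n hn, hN (n + 1) (by omega)⟩

theorem abs_measureReal_scale_sub_le (hd : 0 < d) {J : Set ℕ} {Y : ℕ → 𝔼} {C : ℕ → Closeds 𝔼}
    {τ : ℝ} (hC : ∀ i, (C i : Set 𝔼) ⊆ Metric.closedBall 0 τ) {ρ η q : ℝ} (hρ : 0 < ρ)
    (hη0 : 0 < η) (hη : η ≤ 1) (hqη : q ^ 2 ≤ (1 + η) ^ d) {D L : ℝ} (hD0 : 0 < D)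
    (hL : 0 < L) (hD : D ^ d * L = ρ) (hD1 : D ≤ 1 / 2) {A : Set 𝔼} {r : ℝ}
    (hA : A ⊆ Metric.closedBall 0 r) (k : ℕ) {ε s : ℝ} (hs0 : 0 ≤ s)
    (hfin : {i | i ∈ J ∧ Y i ∈ Metric.closedBall 0 (r + τ)}.Finite)
    (hsum : ∑ᶠ i ∈ {i | i ∈ J ∧ Y i ∈ Metric.closedBall 0 (r + τ)},
      shapeDefect η τ (C i) ≤ L * s)
    (hs : 2 ^ d * ρ * s ≤ ε) {x : ℝ} (hx : 0 < x) (hx1 : ρ ≤ q ^ 2 * (x ^ d * L))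
    (hx2 : x ^ d * L ≤ q ^ 2 * ρ) :
    |volume.real (A ∩ sparseSet k J Y (fun i => x • (C i : Set 𝔼))) -
      volume.real (A ∩ sparseSet k J Y (fun i => D • (C i : Set 𝔼)))| ≤ ε := by
  obtain ⟨b1, b2⟩ := scale_near hd hη0 hρ hqη hx hD0 hL hD hx1 hx2
  -- This is the source of 2^d in the error. With D ≤ 1/2 it also gives x ≤ 1, needed to localize
  -- the centres of the sets that meet A.
  have hx2D : x ≤ 2 * D := by nlinarith
  have a1 := measureReal_inter_sparseSet_scale_le hC hA hfin hη0 hη hD0 (by linarith) hx b2 b1 k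
  have a2 := measureReal_inter_sparseSet_scale_le hC hA hfin hη0 hη hx (by linarith) hD0 b1 b2 k
  have e2 : D ^ d * (L * s) = ρ * s := by rw [← mul_assoc, hD]
  have c2 := (mul_le_mul_of_nonneg_left hsum (pow_pos hD0 d).le).trans_eq e2
  have hxd : x ^ d ≤ 2 ^ d * D ^ d := by
    rw [← mul_pow]; exact pow_le_pow_left₀ hx.le hx2D d
  have c1 : x ^ d * (∑ᶠ i ∈ {i | i ∈ J ∧ Y i ∈ Metric.closedBall 0 (r + τ)},
      shapeDefect η τ (C i)) ≤ 2 ^ d * ρ * s := by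
    calc _ ≤ x ^ d * (L * s) := mul_le_mul_of_nonneg_left hsum (pow_pos hx d).le
      _ ≤ 2 ^ d * D ^ d * (L * s) := mul_le_mul_of_nonneg_right hxd (by positivity)
      _ = 2 ^ d * ρ * s := by rw [mul_assoc, e2]; ring
  have c3 : ρ * s ≤ 2 ^ d * ρ * s := by
    rw [mul_assoc]
    exact le_mul_of_one_le_left (by positivity) (one_le_pow₀ (by norm_num))
  rw [abs_le]
  constructor <;> linarith

/-- Passing from a geometric sequence of intensities to all intensities. -/
theorem Coupled.eventually_abs_sub_le (hd : 0 < d) {X : ℝ → ℕ → 𝔼} {I : ℝ → Set ℕ}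
    (h : Coupled X I) {C : ℕ → Closeds 𝔼} {τ : ℝ}
    (hC : ∀ i, (C i : Set 𝔼) ⊆ Metric.closedBall 0 τ) {δ : ℝ → ℝ}
    (hδ0 : ∀ l, 0 < l → 0 < δ l) {ρ : ℝ} (hρ : 0 < ρ)
    (hδρ : Tendsto (fun l => δ l ^ d * l) atTop (𝓝 ρ)) {η q : ℝ} (hη0 : 0 < η) (hη : η ≤ 1)
    (hq : 1 < q) (hqη : q ^ 2 ≤ (1 + η) ^ d) {D : ℕ → ℝ} (hD0 : ∀ n, 0 < D n)
    (hD : ∀ n, D n ^ d * q ^ n = ρ) {A : Closeds 𝔼} {r : ℝ}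
    (hA : (A : Set 𝔼) ⊆ Metric.closedBall 0 r) {k : ℕ} {v ε s : ℝ} (hs0 : 0 ≤ s)
    (h1 : ∀ᶠ n in atTop, |volume.real ((A : Set 𝔼) ∩ sparseSet k (I (q ^ n)) (X (q ^ n))
      (fun i => D n • (C i : Set 𝔼))) - v| ≤ ε)
    (h2 : ∀ᶠ n in atTop,
      {i | i ∈ I (q ^ n) ∧ X (q ^ n) i ∈ Metric.closedBall 0 (r + τ)}.Finite ∧
      ∑ᶠ i ∈ {i | i ∈ I (q ^ n) ∧ X (q ^ n) i ∈ Metric.closedBall 0 (r + τ)},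
        shapeDefect η τ (C i) ≤ q ^ n * s)
    (hs : 2 ^ d * ρ * s ≤ ε) (hAε : shapeDefect η r A ≤ ε) :
    ∀ᶠ l in atTop, |volume.real ((A : Set 𝔼) ∩ sparseSet k (I l) (X l)
      (fun i => δ l • (C i : Set 𝔼))) - v| ≤ 3 * ε := by
  have hq0 : 0 < q := one_pos.trans hq
  have hAf : volume (A : Set 𝔼) ≠ ∞ := measure_ne_top_of_subset hA measure_closedBall_lt_top.ne
  have h3 : ∀ᶠ n in atTop, D n ≤ 1 / 2 := by
    have hlim : Tendsto (fun n : ℕ => q ^ n) atTop atTop := tendsto_pow_atTop_atTop_of_one_lt hq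
    filter_upwards [hlim.eventually_ge_atTop (ρ * 2 ^ d)] with n hn
    refine le_of_pow_le_pow_left₀ hd.ne' (by norm_num) ?_
    have hqn : 0 < q ^ n := pow_pos hq0 n
    rw [div_pow, one_pow, le_div_iff₀ (by positivity)]
    refine le_of_mul_le_mul_right ?_ hqn
    calc D n ^ d * 2 ^ d * q ^ n = (D n ^ d * q ^ n) * 2 ^ d := by ring
      _ = ρ * 2 ^ d := by rw [hD]
      _ ≤ 1 * q ^ n := by rw [one_mul]; exact hn
  have h4 : ∀ᶠ l in atTop, ρ ≤ q * (δ l ^ d * l) := by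
    have : ρ / q < ρ := div_lt_self hρ hq
    filter_upwards [hδρ.eventually_const_le this] with l hl
    rwa [div_le_iff₀' hq0] at hl
  have h5 : ∀ᶠ l in atTop, δ l ^ d * l ≤ q * ρ :=
    hδρ.eventually_le_const (by nlinarith)
  filter_upwards [eventually_exists_pow_near hq ((h1.and h2).and h3), h4, h5,
    eventually_gt_atTop 0] with l ⟨n, hn1, hn2, ⟨⟨p1, p2, p3⟩, p4⟩, ⟨⟨r1, r2, r3⟩, r4⟩⟩ l4 l5 l0
  have hqn : 0 < q ^ n := pow_pos hq0 n
  have hδl := hδ0 l l0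
  have hδd : 0 < δ l ^ d := pow_pos hδl d
  have hsq : ∀ c : ℝ, 1 ≤ c → c ^ d ≤ q → c ≤ 1 + η := fun c hc hcq => by
    refine le_of_pow_le_pow_left₀ hd.ne' (by positivity) (hcq.trans (le_trans ?_ hqη))
    nlinarith
  have hu : 0 < δ l ^ d * l := mul_pos hδd l0
  have hqq : q * (δ l ^ d * l) ≤ q ^ 2 * (δ l ^ d * l) := by nlinarith
  have hqρ : q * ρ ≤ q ^ 2 * ρ := by nlinarith
  -- The upper bound compares with the smaller intensity q^n. The three ε come from the convergence
  -- along q^n, the change of scale and the deformation of the window.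
  have upper : volume.real ((A : Set 𝔼) ∩ sparseSet k (I l) (X l)
      (fun i => δ l • (C i : Set 𝔼))) ≤ v + 3 * ε := by
    obtain ⟨c, hc1, hc⟩ := exists_pow_mul_eq hd hqn hn1
    have hcd1 : 1 ≤ c ^ d := one_le_pow₀ hc1
    have hcq : c ^ d ≤ q := by
      refine le_of_mul_le_mul_right ?_ hqn
      rw [hc]; rw [pow_succ] at hn2; linarith
    obtain ⟨δ', hδ', hle⟩ := h.measureReal_le hd hqn hc1 hc hδl k (fun i => (C i : Set 𝔼)) hAf
    have hc0 : 0 < c := one_pos.trans_le hc1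
    have hδ'0 : 0 < δ' := by rcases hδ' with rfl | rfl <;> positivity
    have hb : ρ ≤ q ^ 2 * (δ' ^ d * q ^ n) ∧ δ' ^ d * q ^ n ≤ q ^ 2 * ρ := by
      rcases hδ' with rfl | rfl
      · have e : δ l ^ d * l = c ^ d * (δ l ^ d * q ^ n) := by
          linear_combination -(δ l ^ d) * hc
        have hw : 0 < δ l ^ d * q ^ n := by positivity
        rw [e] at l4 l5
        constructor
        · calc ρ ≤ q * (c ^ d * (δ l ^ d * q ^ n)) := l4
            _ ≤ q * (q * (δ l ^ d * q ^ n)) := by gcongr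
            _ = _ := by ring
        · nlinarith
      · have e : (c * δ l) ^ d * q ^ n = δ l ^ d * l := by rw [← hc]; ring
        rw [e]
        exact ⟨l4.trans hqq, l5.trans hqρ⟩
    have hcm := abs_measureReal_scale_sub_le hd hC hρ hη0 hη hqη (hD0 n) hqn (hD n) p4 hA k hs0
      p2 p3 hs hδ'0 hb.1 hb.2
    have hdef := measureReal_smul_diff_smul_le hη one_pos (by linarith [hsq c hc1 hcq] :
      c ≤ (1 + η) * 1) (by nlinarith) hη0 A hA
    rw [one_smul, one_pow, one_mul] at hdef
    linarith [(abs_le.mp hcm).2, (abs_le.mp p1).2]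
  -- The lower bound compares with the larger intensity q^(n+1).
  have lower : v ≤ volume.real ((A : Set 𝔼) ∩ sparseSet k (I l) (X l)
      (fun i => δ l • (C i : Set 𝔼))) + 3 * ε := by
    obtain ⟨c, hc1, hc⟩ := exists_pow_mul_eq hd l0 hn2.le
    have hcd1 : 1 ≤ c ^ d := one_le_pow₀ hc1
    have hcq : c ^ d ≤ q := by
      refine le_of_mul_le_mul_right ?_ l0
      rw [hc, pow_succ]; nlinarith
    obtain ⟨δ', hδ', hle⟩ := h.le_measureReal hd l0 hc1 hc hδl k (fun i => (C i : Set 𝔼)) hAf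
    have hc0 : 0 < c := one_pos.trans_le hc1
    have hδ'0 : 0 < δ' := by rcases hδ' with rfl | rfl <;> positivity
    have hb : ρ ≤ q ^ 2 * (δ' ^ d * q ^ (n + 1)) ∧ δ' ^ d * q ^ (n + 1) ≤ q ^ 2 * ρ := by
      rcases hδ' with rfl | rfl
      · have e : δ l ^ d * q ^ (n + 1) = c ^ d * (δ l ^ d * l) := by rw [← hc]; ring
        rw [e]
        constructor
        · calc ρ ≤ q * (δ l ^ d * l) := l4
            _ ≤ q ^ 2 * (δ l ^ d * l) := hqq
            _ ≤ q ^ 2 * (c ^ d * (δ l ^ d * l)) := by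
              refine mul_le_mul_of_nonneg_left ?_ (by positivity)
              exact le_mul_of_one_le_left hu.le hcd1
        · calc c ^ d * (δ l ^ d * l) ≤ q * (q * ρ) := by gcongr
            _ = _ := by ring
      · have e : (c⁻¹ * δ l) ^ d * q ^ (n + 1) = δ l ^ d * l := by
          rw [← hc, mul_pow, inv_pow]
          field_simp
        rw [e]
        exact ⟨l4.trans hqq, l5.trans hqρ⟩
    have hcm := abs_measureReal_scale_sub_le hd hC hρ hη0 hη hqη (hD0 (n + 1)) (pow_pos hq0 _)
      (hD (n + 1)) r4 hA k hs0 r2 r3 hs hδ'0 hb.1 hb.2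
    have hci : c⁻¹ ≤ 1 := inv_le_one_of_one_le₀ hc1
    have hdef := measureReal_smul_diff_smul_le (a := 1) (b := c⁻¹) hη (inv_pos.mpr hc0) (by
        rw [← div_eq_mul_inv, le_div_iff₀ hc0]; linarith [hsq c hc1 hcq]) (by linarith) hη0 A hA
    rw [one_smul] at hdef
    have hdef2 : (c⁻¹) ^ d * shapeDefect η r A ≤ shapeDefect η r A :=
      mul_le_of_le_one_left (shapeDefect_nonneg _ _ _) (pow_le_one₀ (by positivity) hci)
    linarith [(abs_le.mp hcm).1, (abs_le.mp r1).1]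
  rw [abs_le]
  constructor <;> linarith

/-- The case of vanishing covering density. -/
theorem Coupled.tendsto_of_zero (hd : 0 < d) {X : ℝ → ℕ → 𝔼} {I : ℝ → Set ℕ}
    (h : Coupled X I) {C : ℕ → Closeds 𝔼} {τ : ℝ}
    (hC : ∀ i, (C i : Set 𝔼) ⊆ Metric.closedBall 0 τ) {δ : ℝ → ℝ}
    (hδ0 : ∀ l, 0 < l → 0 < δ l) (hδ : Tendsto δ atTop (𝓝 0))
    (hδρ : Tendsto (fun l => δ l ^ d * l) atTop (𝓝 0)) {q : ℝ} (hq : 1 < q) {A : Set 𝔼} {r : ℝ}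
    (hA : A ⊆ Metric.closedBall 0 r) {k : ℕ} (hk : 0 < k) {s : ℝ}
    (h2 : ∀ᶠ n in atTop,
      {i | i ∈ I (q ^ n) ∧ X (q ^ n) i ∈ Metric.closedBall 0 (r + τ)}.Finite ∧
      ∑ᶠ i ∈ {i | i ∈ I (q ^ n) ∧ X (q ^ n) i ∈ Metric.closedBall 0 (r + τ)},
        volume.real (Metric.closedBall (0 : 𝔼) τ) ≤ q ^ n * s) :
    Tendsto (fun l => volume.real (A ∩ sparseSet k (I l) (X l)
      (fun i => δ l • (C i : Set 𝔼)))) atTop (𝓝 (volume.real A)) := by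
  have hq0 : 0 < q := one_pos.trans hq
  have hAf : volume A ≠ ∞ := measure_ne_top_of_subset hA measure_closedBall_lt_top.ne
  have hlow : Tendsto (fun l => volume.real A - δ l ^ d * l * (q * |s|)) atTop
      (𝓝 (volume.real A)) := by
    simpa using (hδρ.mul_const (q * |s|)).const_sub (volume.real A)
  refine tendsto_of_tendsto_of_tendsto_of_le_of_le' hlow tendsto_const_nhds ?_
    (Eventually.of_forall fun l => measureReal_mono Set.inter_subset_left hAf)
  filter_upwards [eventually_exists_pow_near hq h2, hδ.eventually_le_const one_pos,
    eventually_gt_atTop 0] with l ⟨n, hn1, hn2, _, hfin, hsum⟩ hδ1 l0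
  have hδl := hδ0 l l0
  obtain ⟨c, hc1, hc⟩ := exists_pow_mul_eq hd l0 hn2.le
  have hsub : {i | i ∈ I l ∧ X l i ∈ Metric.closedBall 0 (r + τ)} ⊆
      {i | i ∈ I (q ^ (n + 1)) ∧ X (q ^ (n + 1)) i ∈ Metric.closedBall 0 (r + τ)} :=
    fun i hi => h.mem_ball hd l0 hc1 hc hi.1 hi.2
  have hfin' := hfin.subset hsub
  have hCf : ∀ i, volume (C i : Set 𝔼) ≠ ∞ := fun i =>
    measure_ne_top_of_subset (hC i) measure_closedBall_lt_top.ne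
  -- Comparison with empty shapes, for which all of A is sparse; the error is the total volume of
  -- the sets centred near A.
  have key := measureReal_inter_sparseSet_le (k := k) (S := fun i => δ l • (C i : Set 𝔼))
    (S' := fun _ => ∅) hAf (fun i _ h => mem_closedBall_of_meets (hC i) hA hδl hδ1 h) hfin'
    (fun i => volume_smul_ne_top (hCf i) _)
  have hempty : A ∩ sparseSet k (I l) (X l) (fun _ => (∅ : Set 𝔼)) = A := by
    refine Set.inter_eq_left.mpr fun x _ => ?_
    have : coverIdx (I l) (X l) (fun _ => (∅ : Set 𝔼)) x = ∅ := by
      ext i; simp [coverIdx]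
    simp [sparseSet, this, hk]
  rw [hempty] at key
  have hsum2 : ∑ᶠ i ∈ {i | i ∈ I l ∧ X l i ∈ Metric.closedBall 0 (r + τ)},
      volume.real (δ l • (C i : Set 𝔼) \ ∅) ≤ δ l ^ d * l * (q * |s|) := by
    rw [finsum_mem_eq_finite_toFinset_sum _ hfin']
    replace hsum := (finsum_mem_eq_finite_toFinset_sum
      (fun _ => volume.real (Metric.closedBall (0 : 𝔼) τ)) hfin).symm.trans_le hsum
    calc _ ≤ ∑ i ∈ hfin'.toFinset, δ l ^ d * volume.real (Metric.closedBall (0 : 𝔼) τ) := by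
          refine Finset.sum_le_sum fun i _ => ?_
          rw [Set.sdiff_empty, measureReal_def, Measure.addHaar_smul, finrank_euclideanSpace,
            Fintype.card_fin, ENNReal.toReal_mul, ENNReal.toReal_ofReal (abs_nonneg _),
            abs_of_pos (pow_pos hδl d), ← measureReal_def]
          exact mul_le_mul_of_nonneg_left
            (measureReal_mono (hC i) measure_closedBall_lt_top.ne) (pow_pos hδl d).le
      _ ≤ ∑ i ∈ hfin.toFinset, δ l ^ d * volume.real (Metric.closedBall (0 : 𝔼) τ) :=
          Finset.sum_le_sum_of_subset_of_nonneg (Set.Finite.toFinset_subset_toFinset.mpr hsub)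
            (fun i _ _ => mul_nonneg (pow_pos hδl d).le measureReal_nonneg)
      _ = δ l ^ d * ∑ i ∈ hfin.toFinset, volume.real (Metric.closedBall (0 : 𝔼) τ) := by
          rw [Finset.mul_sum]
      _ ≤ δ l ^ d * (q ^ (n + 1) * s) := mul_le_mul_of_nonneg_left hsum (pow_pos hδl d).le
      _ ≤ δ l ^ d * (l * (q * |s|)) := by
          refine mul_le_mul_of_nonneg_left ?_ (pow_pos hδl d).le
          calc q ^ (n + 1) * s ≤ q ^ (n + 1) * |s| :=
                mul_le_mul_of_nonneg_left (le_abs_self s) (pow_pos hq0 _).le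
            _ = q ^ n * (q * |s|) := by ring
            _ ≤ l * (q * |s|) := mul_le_mul_of_nonneg_right hn1 (by positivity)
      _ = δ l ^ d * l * (q * |s|) := by ring
  linarith

end Deterministic

/-! ### The almost sure limit for compact windows and for Borel sets -/

section Main

variable {Ω : Type*} [MeasurableSpace Ω] {d : ℕ} {μ : Measure Ω}
  {Q : Measure (Closeds (EuclideanSpace ℝ (Fin d)))}
  {X : ℝ → ℕ → Ω → EuclideanSpace ℝ (Fin d)} {I : ℝ → Ω → Set ℕ}
  {C : ℕ → Ω → Closeds (EuclideanSpace ℝ (Fin d))}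

local notation "𝔼" => EuclideanSpace ℝ (Fin d)

theorem summable_inv_pow {q : ℝ} (hq : 1 < q) : Summable fun n : ℕ => (q ^ n)⁻¹ := by
  simp only [← inv_pow]
  exact summable_geometric_of_lt_one (by positivity) (inv_lt_one_of_one_lt₀ hq)

theorem ae_coupled (hjoint : IsNested μ X I ∨ IsRescaled μ X I) :
    ∀ᵐ ω ∂μ, Coupled (fun l i => X l i ω) (fun l => I l ω) := by
  rcases hjoint with h | h
  · filter_upwards [h] with ω hω using Or.inl hω
  · filter_upwards [h] with ω hω using Or.inr hω

theorem ae_eventually_abs_sub_le [IsProbabilityMeasure μ] (hd : 0 < d)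
    (hm : ∀ l : ℝ, 0 < l → IsModel μ l Q (X l) (I l) C) {τ : ℝ} (hτ : 0 < τ)
    (hQ : ∀ᵐ F : Closeds 𝔼 ∂Q, (F : Set 𝔼) ⊆ Metric.closedBall 0 τ)
    (hjoint : IsNested μ X I ∨ IsRescaled μ X I) {δ : ℝ → ℝ} (hδ0 : ∀ l, 0 < l → 0 < δ l)
    {ρ : ℝ} (hρ : 0 < ρ) (hδρ : Tendsto (fun l => δ l ^ d * l) atTop (𝓝 ρ))
    (A : Closeds 𝔼) {r : ℝ} (hA : (A : Set 𝔼) ⊆ Metric.closedBall 0 r) (k : ℕ) {β : ℝ}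
    (hβ : β = ∫ F, volume.real (F : Set 𝔼) ∂Q) {ε : ℝ} (hε : 0 < ε) :
    ∀ᵐ ω ∂μ, ∀ᶠ l in atTop, |volume.real ((A : Set 𝔼) ∩ sparseSet k (I l ω) (fun i => X l i ω)
      (fun i => δ l • (C i ω : Set 𝔼))) - volume.real (A : Set 𝔼) * (Real.exp (-(ρ * β)) *
        ∑ j ∈ Finset.range k, (ρ * β) ^ j / (j.factorial : ℝ))| ≤ 3 * ε := by
  have hQP := isProbabilityMeasure_shapeLaw (hm 1 one_pos)
  have hAf : volume (A : Set 𝔼) ≠ ∞ := measure_ne_top_of_subset hA measure_closedBall_lt_top.ne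
  set B : Set 𝔼 := Metric.closedBall 0 (r + τ) with hB
  have hBf : volume B ≠ ∞ := measure_closedBall_lt_top.ne
  set K := volume.real (Metric.closedBall (0 : 𝔼) (2 * τ)) with hK
  -- If the mean shell volume and the slack in the law of large numbers are both at most e, the
  -- shape error is at most M e; hence e = min (ε/M) ε below.
  set M := 2 ^ d * ρ * (volume.real B * Real.exp K + 1) with hM
  have hM0 : 0 < M := by positivity
  obtain ⟨η, hη0, hη1, hη2, hη3⟩ := exists_shapeDefect_small hQ A hA
    (lt_min (div_pos hε hM0) hε)
  -- For η ≤ 1 this gives q^2 ≤ 1 + η.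
  set q : ℝ := 1 + η / 3 with hq
  have hq1 : 1 < q := by linarith
  have hq0 : 0 < q := one_pos.trans hq1
  have hqη : q ^ 2 ≤ (1 + η) ^ d := by
    have h1 : 1 + η ≤ (1 + η) ^ d := le_self_pow₀ (by linarith) hd.ne'
    nlinarith
  set D : ℕ → ℝ := fun n => (ρ / q ^ n) ^ ((d : ℝ)⁻¹) with hD
  have hD0 : ∀ n, 0 < D n := fun n => by positivity
  have hDn : ∀ n, D n ^ d * q ^ n = ρ := fun n => by
    rw [hD, Real.rpow_inv_natCast_pow (by positivity) hd.ne', div_mul_cancel₀ _ (by positivity)]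
  have hL : ∀ n : ℕ, 0 < q ^ n := fun n => pow_pos hq0 n
  set e := min (ε / M) ε with he
  have he0 : 0 < e := lt_min (div_pos hε hM0) hε
  have h1 := ae_tendsto_sparseSet hL (summable_inv_pow hq1) (fun n => hm (q ^ n) (hL n)) hτ.le hQ
    hD0 hDn hβ hAf k
  have h2 := ae_eventually_finsum_le hL (summable_inv_pow hq1) (fun n => hm (q ^ n) (hL n))
    (measurableSet_closedBall (x := (0 : 𝔼)) (ε := r + τ)) hBf (measurable_shapeDefect η τ)
    (shapeDefect_nonneg η τ) (shapeDefect_le η τ) he0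
  filter_upwards [h1, h2, ae_coupled hjoint, ae_shape_subset (hm 1 one_pos) hQ] with ω w1 w2 w3 w4
  have hint0 : 0 ≤ ∫ F : Closeds 𝔼, shapeDefect η τ F ∂Q :=
    integral_nonneg fun F => shapeDefect_nonneg _ _ _
  refine w3.eventually_abs_sub_le hd w4 hδ0 hρ hδρ hη0 hη1 hq1 hqη hD0 hDn hA
    (s := volume.real B * (Real.exp K * ∫ F, shapeDefect η τ F ∂Q) + e) (by positivity)
    ?_ w2 ?_ (hη3.le.trans (min_le_right _ _))
  · filter_upwards [Metric.tendsto_nhds.mp w1 ε hε] with n hn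
    exact (Real.dist_eq _ _ ▸ hn).le
  · calc 2 ^ d * ρ * (volume.real B * (Real.exp K * ∫ F, shapeDefect η τ F ∂Q) + e)
        ≤ 2 ^ d * ρ * (volume.real B * (Real.exp K * e) + e) := by gcongr
      _ = M * e := by rw [hM]; ring
      _ ≤ M * (ε / M) := by gcongr; exact min_le_left _ _
      _ = ε := mul_div_cancel₀ _ hM0.ne'

theorem ae_tendsto_measureReal_isCompact [IsProbabilityMeasure μ] (hd : 0 < d)
    (hm : ∀ l : ℝ, 0 < l → IsModel μ l Q (X l) (I l) C) {τ : ℝ} (hτ : 0 < τ)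
    (hQ : ∀ᵐ F : Closeds 𝔼 ∂Q, (F : Set 𝔼) ⊆ Metric.closedBall 0 τ)
    (hjoint : IsNested μ X I ∨ IsRescaled μ X I) {δ : ℝ → ℝ} (hδ0 : ∀ l, 0 < l → 0 < δ l)
    (hδ : Tendsto δ atTop (𝓝 0)) {ρ : ℝ} (hρ : 0 ≤ ρ)
    (hδρ : Tendsto (fun l => δ l ^ d * l) atTop (𝓝 ρ)) {A : Set 𝔼} (hAc : IsCompact A) {k : ℕ}
    (hk : 0 < k) {β : ℝ} (hβ : β = ∫ F, volume.real (F : Set 𝔼) ∂Q) :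
    ∀ᵐ ω ∂μ, Tendsto (fun l => volume.real (A ∩ sparseSet k (I l ω) (fun i => X l i ω)
      (fun i => δ l • (C i ω : Set 𝔼)))) atTop
      (𝓝 (volume.real A * (Real.exp (-(ρ * β)) *
        ∑ j ∈ Finset.range k, (ρ * β) ^ j / (j.factorial : ℝ)))) := by
  obtain ⟨r, hr⟩ := hAc.isBounded.subset_closedBall 0
  rcases hρ.eq_or_lt with rfl | hρ
  · have hsum : ∑ j ∈ Finset.range k, (0 * β) ^ j / (j.factorial : ℝ) = 1 := by
      rw [Finset.sum_eq_single 0]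
      · simp
      · intro j _ hj
        simp [hj]
      · intro h
        exact absurd (Finset.mem_range.mpr hk) h
    rw [hsum, zero_mul, neg_zero, Real.exp_zero, mul_one, mul_one]
    have hL : ∀ n : ℕ, (0 : ℝ) < 2 ^ n := fun n => by positivity
    have h2 := ae_eventually_finsum_le hL (summable_inv_pow one_lt_two)
      (fun n => hm (2 ^ n) (hL n)) (measurableSet_closedBall (x := (0 : 𝔼)) (ε := r + τ))
      measure_closedBall_lt_top.ne
      (f := fun _ => volume.real (Metric.closedBall (0 : 𝔼) τ)) measurable_const
      (fun _ => measureReal_nonneg) (fun _ => le_rfl) one_pos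
    filter_upwards [h2, ae_coupled hjoint, ae_shape_subset (hm 1 one_pos) hQ] with ω w2 w3 w4
    exact w3.tendsto_of_zero hd w4 hδ0 hδ hδρ one_lt_two hr hk w2
  · have h1 := fun n : ℕ => ae_eventually_abs_sub_le hd hm hτ hQ hjoint hδ0 hρ hδρ
      ⟨A, hAc.isClosed⟩ hr k hβ (ε := 1 / (n + 1 : ℝ)) (by positivity)
    filter_upwards [ae_all_iff.mpr h1] with ω hω
    rw [Metric.tendsto_nhds]
    intro ε hε
    obtain ⟨n, hn⟩ := exists_nat_one_div_lt (show 0 < ε / 3 by positivity)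
    filter_upwards [hω n] with l hl
    rw [Real.dist_eq]
    refine lt_of_le_of_lt hl ?_
    linarith

/-- Since `halfPow` takes the value 2^(-m) only at m, the set is a level set of the measurable
weight. -/
theorem measurableSet_coverIdx_encard {lam : ℝ} {Y : ℕ → Ω → 𝔼} {J : Ω → Set ℕ}
    (hm : IsModel μ lam Q Y J C) {δ : ℝ} (hδ : 0 < δ) (ω : Ω) (m : ℕ) :
    MeasurableSet {x | (coverIdx (J ω) (fun i => Y i ω) (fun i => δ • (C i ω : Set 𝔼)) x).encard
      = (m : ℕ∞)} := by
  have hinj : ∀ N : ℕ∞, N = m ↔ halfPow N = (1 / 2) ^ m := by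
    intro N
    induction N using ENat.recTopCoe with
    | top => simpa [halfPow] using (pow_pos two_pos m).ne
    | coe n =>
      have hn : halfPow (n : ℕ∞) = (1 / 2) ^ n := by simp [halfPow]
      rw [hn, Nat.cast_inj, pow_right_inj₀ (by norm_num) (by norm_num)]
  have : {x | (coverIdx (J ω) (fun i => Y i ω) (fun i => δ • (C i ω : Set 𝔼)) x).encard
      = (m : ℕ∞)} = (fun x => coverWeight Y J C δ ω x) ⁻¹' {(1 / 2) ^ m} := by
    ext x
    simp only [Set.mem_ofPred_eq, hinj, coverWeight, Set.mem_preimage, Set.mem_singleton_iff]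
  rw [this]
  exact ((measurable_coverWeight hm hδ).comp measurable_prodMk_left) (measurableSet_singleton _)

theorem sparseSet_eq_iUnion {E : Type*} [Add E] (k : ℕ) (J : Set ℕ) (Y : ℕ → E) (S : ℕ → Set E) :
    sparseSet k J Y S = ⋃ m ∈ Finset.range k, {x | (coverIdx J Y S x).encard = (m : ℕ∞)} := by
  ext x
  simp only [sparseSet, Set.mem_ofPred_eq, Set.mem_iUnion, Finset.mem_range, exists_prop]
  constructor
  · intro h
    obtain ⟨m, hm⟩ := ENat.ne_top_iff_exists.mp h.ne_top
    rw [← hm] at h ⊢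
    exact ⟨m, by exact_mod_cast h, rfl⟩
  · rintro ⟨m, hm, h⟩
    rw [h]
    exact_mod_cast hm

theorem vacancy_eq_measure {lam : ℝ} {Y : ℕ → Ω → 𝔼} {J : Ω → Set ℕ}
    (hm : IsModel μ lam Q Y J C) {δ : ℝ} (hδ : 0 < δ) (ω : Ω) (k : ℕ) {R : Set 𝔼} :
    vacancy k R (J ω) (fun i => Y i ω) (fun i => δ • (C i ω : Set 𝔼))
      = volume (R ∩ sparseSet k (J ω) (fun i => Y i ω) (fun i => δ • (C i ω : Set 𝔼))) := by
  have hms := measurableSet_coverIdx_encard hm hδ ω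
  rw [sparseSet_eq_iUnion, Set.inter_comm, ← Measure.restrict_apply
    (Finset.measurableSet_biUnion _ fun m _ => hms m), measure_biUnion_finset _ (fun m _ => hms m)]
  · refine Finset.sum_congr rfl fun m _ => ?_
    rw [← lintegral_indicator_one (hms m)]
    refine lintegral_congr fun x => ?_
    simp only [exactlyCovered, Set.indicator, Set.mem_ofPred_eq, coverIdx, Pi.one_apply]
    congr
  · intro a _ b _ hab
    refine Set.disjoint_left.mpr fun x hx hy => hab ?_
    have : (a : ℕ∞) = b := (show _ = (a : ℕ∞) from hx).symm.trans hy
    exact_mod_cast this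

theorem tendsto_measure_inter_of_isCompact {E : Type*} [MeasurableSpace E] {ν : Measure E}
    {R : Set E} {K : ℕ → Set E} (hKR : ∀ m, K m ⊆ R) (hKm : ∀ m, MeasurableSet (K m))
    (hKν : ∀ m, ν (K m) ≠ ∞) (hK : Tendsto (fun m => ν (K m)) atTop (𝓝 (ν R)))
    {U : ℝ → Set E} {c : ℝ≥0∞} (hc0 : c ≠ 0) (hc : c ≠ ∞)
    (h : ∀ m, Tendsto (fun l => ν (K m ∩ U l)) atTop (𝓝 (ν (K m) * c))) :
    Tendsto (fun l => ν (R ∩ U l)) atTop (𝓝 (ν R * c)) := by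
  have hKc : Tendsto (fun m => ν (K m) * c) atTop (𝓝 (ν R * c)) :=
    ENNReal.Tendsto.mul_const hK (Or.inr hc)
  rw [tendsto_order]
  constructor
  · intro a ha
    obtain ⟨m, hm⟩ := (hKc.eventually_const_lt ha).exists
    filter_upwards [(h m).eventually_const_lt hm] with l hl
    exact hl.trans_le (measure_mono (Set.inter_subset_inter_left _ (hKR m)))
  · intro a ha
    -- For infinite volume the limit is ∞ because c ≠ 0, so no a lies above it and only the lower
    -- bound matters.
    have hR : ν R ≠ ∞ := by
      intro hR
      rw [hR, ENNReal.top_mul hc0] at ha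
      exact not_top_lt ha
    have hdiff : Tendsto (fun m => ν (R \ K m)) atTop (𝓝 0) := by
      have := ENNReal.Tendsto.sub (tendsto_const_nhds (x := ν R)) hK (Or.inl hR)
      rw [tsub_self] at this
      refine this.congr fun m => ?_
      rw [measure_sdiff (hKR m) (hKm m).nullMeasurableSet (hKν m)]
    have hsum := hKc.add hdiff
    rw [add_zero] at hsum
    obtain ⟨m, hm⟩ := (hsum.eventually_lt_const ha).exists
    have h2 := (h m).add_const (ν (R \ K m))
    filter_upwards [h2.eventually_lt_const hm] with l hl
    refine lt_of_le_of_lt ?_ hl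
    refine (measure_mono ?_).trans (measure_union_le _ _)
    rintro x ⟨h1, h2⟩
    by_cases hx : x ∈ K m
    · exact Or.inl ⟨hx, h2⟩
    · exact Or.inr ⟨h1, hx⟩

theorem exists_seq_isCompact_tendsto_measure {R : Set 𝔼} (hR : MeasurableSet R) :
    ∃ K : ℕ → Set 𝔼, (∀ m, K m ⊆ R) ∧ (∀ m, IsCompact (K m)) ∧
      Tendsto (fun m => volume (K m)) atTop (𝓝 (volume R)) := by
  have hlub : sSup {v | ∃ K ⊆ R, IsCompact K ∧ volume K = v} = volume R := by
    refine le_antisymm (sSup_le ?_) (le_of_forall_lt fun a ha => ?_)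
    · rintro v ⟨K, hKR, -, rfl⟩
      exact measure_mono hKR
    · obtain ⟨K, hKR, hKc, hK⟩ := hR.exists_lt_isCompact ha
      exact hK.trans_le (le_sSup ⟨K, hKR, hKc, rfl⟩)
  obtain ⟨u, -, hu, hmem⟩ := exists_seq_tendsto_sSup
    (S := {v | ∃ K ⊆ R, IsCompact K ∧ (volume : Measure 𝔼) K = v})
    ⟨0, ∅, Set.empty_subset _, isCompact_empty, measure_empty⟩ (OrderTop.bddAbove _)
  choose K hKR hKc hK using hmem
  refine ⟨K, hKR, hKc, ?_⟩
  rw [hlub] at hu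
  exact hu.congr fun m => (hK m).symm

end Main

end PoissonBoolean

theorem theorem1 {d : ℕ} (hd : 0 < d) {Ω : Type*} [MeasurableSpace Ω] (μ : Measure Ω)
    [IsProbabilityMeasure μ]
    -- the law `Q` of the generic shape
    (Q : Measure (Closeds (EuclideanSpace ℝ (Fin d)))) (τ : ℝ) (hτ : 0 < τ)
    (hQ_ball : ∀ᵐ F : Closeds (EuclideanSpace ℝ (Fin d)) ∂Q,
      (F : Set (EuclideanSpace ℝ (Fin d))) ⊆ Metric.closedBall 0 τ)
    (hQ_pos : ∀ᵐ F : Closeds (EuclideanSpace ℝ (Fin d)) ∂Q,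
      0 < volume (F : Set (EuclideanSpace ℝ (Fin d))))
    -- the point processes of all intensities and the unscaled shapes
    (X : ℝ → ℕ → Ω → EuclideanSpace ℝ (Fin d)) (I : ℝ → Ω → Set ℕ)
    (C : ℕ → Ω → Closeds (EuclideanSpace ℝ (Fin d)))
    (hmodel : ∀ lam : ℝ, 0 < lam → PoissonBoolean.IsModel μ lam Q (X lam) (I lam) C)
    (hjoint : PoissonBoolean.IsNested μ X I ∨ PoissonBoolean.IsRescaled μ X I)
    -- the region and the scaling
    (R : Set (EuclideanSpace ℝ (Fin d))) (hR : MeasurableSet R) (k : ℕ) (hk : 0 < k)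
    (δ : ℝ → ℝ) (hδ_pos : ∀ lam : ℝ, 0 < lam → 0 < δ lam) (hδ : Tendsto δ atTop (𝓝 0))
    (ρ : ℝ) (hρ : 0 ≤ ρ) (hδρ : Tendsto (fun lam : ℝ => δ lam ^ d * lam) atTop (𝓝 ρ))
    (β : ℝ) (hβ : β = ∫ F, volume.real (F : Set (EuclideanSpace ℝ (Fin d))) ∂Q) :
    ∀ᵐ ω ∂μ, Tendsto
      (fun lam : ℝ => PoissonBoolean.vacancy k R (I lam ω) (fun i => X lam i ω)
        (fun i => δ lam • (C i ω : Set (EuclideanSpace ℝ (Fin d)))))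
      atTop
      (𝓝 (volume R * ENNReal.ofReal
        (Real.exp (-(ρ * β)) * ∑ j ∈ Finset.range k, (ρ * β) ^ j / (j.factorial : ℝ)))) := by
  have hρβ : 0 ≤ ρ * β := mul_nonneg hρ (hβ ▸ integral_nonneg fun F => measureReal_nonneg)
  -- Positivity comes from the term j = 0, present as k ≥ 1; it gives the limit ∞ when R has
  -- infinite volume.
  have hp : 0 < Real.exp (-(ρ * β)) * ∑ j ∈ Finset.range k, (ρ * β) ^ j / (j.factorial : ℝ) := by
    refine mul_pos (Real.exp_pos _) (Finset.sum_pos' (fun j _ => by positivity)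
      ⟨0, Finset.mem_range.mpr hk, by simp⟩)
  set p := Real.exp (-(ρ * β)) * ∑ j ∈ Finset.range k, (ρ * β) ^ j / (j.factorial : ℝ)
  obtain ⟨K, hKR, hKc, hK⟩ := PoissonBoolean.exists_seq_isCompact_tendsto_measure hR
  have h := fun m => PoissonBoolean.ae_tendsto_measureReal_isCompact hd hmodel hτ hQ_ball hjoint
    hδ_pos hδ hρ hδρ (hKc m) hk hβ
  filter_upwards [ae_all_iff.mpr h] with ω hω
  have hKf : ∀ m, volume (K m) ≠ ∞ := fun m => (hKc m).measure_lt_top.ne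
  refine (PoissonBoolean.tendsto_measure_inter_of_isCompact hKR (fun m => (hKc m).measurableSet)
    hKf hK (U := fun l => PoissonBoolean.sparseSet k (I l ω) (fun i => X l i ω)
      (fun i => δ l • (C i ω : Set (EuclideanSpace ℝ (Fin d))))) (c := ENNReal.ofReal p) (by simpa using hp) ENNReal.ofReal_ne_top
    (fun m => ?_)).congr' ?_
  · have h1 := ENNReal.tendsto_ofReal (hω m)
    rw [ENNReal.ofReal_mul measureReal_nonneg, ofReal_measureReal (hKf m)] at h1
    exact h1.congr fun l =>
      ofReal_measureReal (measure_ne_top_of_subset Set.inter_subset_left (hKf m))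
  · filter_upwards [eventually_gt_atTop 0] with l hl
    exact (PoissonBoolean.vacancy_eq_measure (hmodel l hl) (hδ_pos l hl) ω k).symm
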